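/- **Setting.** Let $n\ge 2$, $p\ge 1$, $\mu>0$, $L\in\mathbb R$. Let $f_1,\dots,f_n:\mathbb R^p\to\mathbb R$ be differentiable with $\langle\nabla f_i(x)-\nabla f_i(x'),x-x'\rangle\ge\mu\|x-x'\|_2^2$ and $\|\nabla f_i(x)-\nabla f_i(x')\|_2\le L\|x-x'\|_2$ for all $x,x'$ and $i$, and let $x^*$ be the minimizer of $\sum_i f_i$. Let $R,C\in\mathbb R^{n\times n}$ be nonnegative with positive diagonals, $R\mathbf 1=\mathbf 1$ and $\mathbf 1^{\top}C=\mathbf 1^{\top}$. For a nonnegative matrix $W$ let $\mathcal G_W$ be the digraph on $\{1,\dots,n\}$ with an edge $j\to i$ iff $W_{ij}>0$. Assume that some node is the root of a directed spanning tree of $\mathcal G_R$ and also of one of $\mathcal G_{C^{\top}}$. Let $u,v\ge 0$ satisfy $u^{\top}R=u^{\top}$, $u^{\top}\mathbf 1=n$, $Cv=v$, $\mathbf 1^{\top}v=n$. **Norms.** For a norm $\|\cdot\|$ on $\mathbb R^n$, use the same symbol for the induced matrix norm, and for $\mathbf x\in\mathbb R^{n\times p}$ let $\|\mathbf x\|$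 be the Euclidean norm of the vector of norms of the columns of $\mathbf x$. Call $\|\cdot\|$ *admissible* for $B\in\mathbb R^{n\times n}$ if $\|w\|_2\le\|w\|$ for all $w\in\mathbb R^n$, $\|W\|=\|W\|_2$ for all diagonal $W$, and $\|B\|<1$. **Algorithm.** For step sizes $\alpha_1,\dots,\alpha_n\ge0$, not all zero, put $\boldsymbol\alpha=\mathrm{diag}(\alpha_1,\dots,\alpha_n)$, $\hat\alpha=\max_i\alpha_i$ and $\alpha'=\frac1n u^{\top}\boldsymbol\alpha v$. From an arbitrary $\mathbf x_0\in\mathbb R^{n\times p}$ and $\mathbf y_0=\nabla F(\mathbf x_0)$, Push-Pull computes $$\mathbf x_{k+1}=R(\mathbf x_k-\boldsymbol\alpha\mathbf y_k),\qquad \mathbf y_{k+1}=C\mathbf y_k+\nabla F(\mathbf x_{k+1})-\nabla F(\mathbf x_k),$$ where row $i$ of $\nabla F(\mathbf x)$ is $\nabla f_i$ at row $i$ of $\mathbf x$. Put $\bar x_k=\frac1n u^{\top}\mathbf x_k$ and $\bar y_k=\frac1n\mathbf 1^{\top}\mathbf y_k$. **Theorem.** There are norms admissible for $R-\frac1n\mathbf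 1u^{\top}$ and norms admissible for $C-\frac1n v\mathbf 1^{\top}$. Let $\|\cdot\|_{\mathrm R}$ and $\|\cdot\|_{\mathrm C}$ be any such norms, respectively, and let $\delta_{\mathrm C,2},\delta_{\mathrm R,\mathrm C}$ be any constants with $\|w\|_{\mathrm C}\le\delta_{\mathrm C,2}\|w\|_2$ and $\|w\|_{\mathrm R}\le\delta_{\mathrm R,\mathrm C}\|w\|_{\mathrm C}$ for all $w\in\mathbb R^n$. Put $\sigma_{\mathrm R}=\|R-\frac1n\mathbf 1u^{\top}\|_{\mathrm R}$, $\sigma_{\mathrm C}=\|C-\frac1n v\mathbf 1^{\top}\|_{\mathrm C}$, $c_0=\|I-\frac1n v\mathbf 1^{\top}\|_{\mathrm C}$ and, for $M>0$, $$c_1=\sigma_{\mathrm R}c_0\delta_{\mathrm C,2}\|R\|_2\|v\|_2\tfrac{L^2}{n\sqrt n}\left[M\delta_{\mathrm R,\mathrm C}n(L+\mu)+\|u\|_2\|v\|_{\mathrm R}L\right],$$ $$\begin{aligned}c_2={}&\sigma_{\mathrm R}c_0\delta_{\mathrm C,2}\|u\|_2\|v\|_{\mathrm R}\|R-I\|_2\tfrac{L^2}{n}+c_0\delta_{\mathrm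 C,2}\|R\|_2\|v\|_2\|u\|_2(1-\sigma_{\mathrm R})\tfrac{L^2}{2n}\\&+M\sigma_{\mathrm R}c_0\delta_{\mathrm R,\mathrm C}\delta_{\mathrm C,2}\|R-I\|_2\mu L+\tfrac M2\sigma_{\mathrm R}\|v\|_{\mathrm R}(1-\sigma_{\mathrm C})\tfrac{L^2}{\sqrt n},\end{aligned}$$ $$c_3=\tfrac M4(1-\sigma_{\mathrm C})(1-\sigma_{\mathrm R})\mu .$$ Suppose that $\alpha'\ge M\hat\alpha$ for some $M>0$ and $$\hat\alpha\le\min\left\{\frac{2c_3}{c_2+\sqrt{c_2^2+4c_1c_3}},\ \frac{1-\sigma_{\mathrm C}}{2\sigma_{\mathrm C}\delta_{\mathrm C,2}\|R\|_2L}\right\},$$ where the second term is $+\infty$ if $\sigma_{\mathrm C}=0$; if $\sigma_{\mathrm R}=0$ (that is, $R=\frac1n\mathbf 1u^{\top}$), suppose also that $\hat\alpha$ is different from the first term. Then the matrix $$A=\begin{bmatrix}1-\alpha'\mu&\frac{\alpha'L}{\sqrt n}&\frac{\hat\alpha\|u\|_2}{n}\\ \hat\alpha\sigma_{\mathrm R}\|v\|_{\mathrm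 R}L&\sigma_{\mathrm R}\left(1+\hat\alpha\|v\|_{\mathrm R}\frac{L}{\sqrt n}\right)&\hat\alpha\sigma_{\mathrm R}\delta_{\mathrm R,\mathrm C}\\ \hat\alpha c_0\delta_{\mathrm C,2}\|R\|_2\|v\|_2L^2&c_0\delta_{\mathrm C,2}L\left(\|R-I\|_2+\hat\alpha\|R\|_2\|v\|_2\frac{L}{\sqrt n}\right)&\sigma_{\mathrm C}+\hat\alpha c_0\delta_{\mathrm C,2}\|R\|_2L\end{bmatrix}$$ has spectral radius $\rho(A)<1$, and $\|\bar x_k-x^*\|_2$, $\|\mathbf x_k-\mathbf 1\bar x_k\|_{\mathrm R}$ and $\|\mathbf y_k-v\bar y_k\|_{\mathrm C}$ are all $\mathcal O(\rho(A)^k)$ as $k\to\infty$; in particular they converge to $0$ linearly. -/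

import Mathlib

open Matrix Asymptotics Filter

namespace PushPull

noncomputable section

/-! ### Objective functions -/

/-- `g` is differentiable, `μ`-strongly convex and has an `L`-Lipschitz gradient. -/
structure StronglyConvexSmooth {p : ℕ} (μ L : ℝ) (g : EuclideanSpace ℝ (Fin p) → ℝ) : Prop where
  differentiable : Differentiable ℝ g
  strong : ∀ x x', μ * ‖x - x'‖ ^ 2 ≤ inner ℝ (gradient g x - gradient g x') (x - x')
  lipschitz : ∀ x x', ‖gradient g x - gradient g x'‖ ≤ L * ‖x - x'‖

/-! ### Digraphs, spanning trees and their roots -/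

/-- The digraph induced by `W`: there is an edge from `j` to `i` iff `W i j > 0`. -/
def inducedEdge {n : ℕ} (W : Matrix (Fin n) (Fin n) ℝ) (j i : Fin n) : Prop := 0 < W i j

/-- `T` is (the edge relation of) a directed spanning tree with root `r` of the digraph with edge
relation `E`: the root has no parent, every other vertex has exactly one parent, and every vertex
is joined to the root by a directed path. -/
structure IsSpanningTree {n : ℕ} (E T : Fin n → Fin n → Prop) (r : Fin n) : Prop where
  subgraph : ∀ i j, T i j → E i j
  root : ∀ i, ¬ T i r
  parent : ∀ j, j ≠ r → ∃! i, T i j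
  reach : ∀ j, Relation.ReflTransGen T r j

/-- The set of roots of all possible spanning trees of the digraph induced by `W`. -/
def roots {n : ℕ} (W : Matrix (Fin n) (Fin n) ℝ) : Set (Fin n) :=
  {r | ∃ T : Fin n → Fin n → Prop, IsSpanningTree (inducedEdge W) T r}

/-! ### The mixing matrices and their Perron vectors -/

/-- `R` is row-stochastic, `C` is column-stochastic (both nonnegative), and both have
positive diagonals. -/
structure StochasticPair {n : ℕ} (R C : Matrix (Fin n) (Fin n) ℝ) : Prop where
  row : R ∈ rowStochastic ℝ (Fin n)
  col : C ∈ colStochastic ℝ (Fin n)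
  diag_row : ∀ i, 0 < R i i
  diag_col : ∀ i, 0 < C i i

/-- `u` is a nonnegative left eigenvector of `R` for the eigenvalue `1`, with `uᵀ 1 = n`. -/
structure IsLeftPerron {n : ℕ} (R : Matrix (Fin n) (Fin n) ℝ) (u : Fin n → ℝ) : Prop where
  nonneg : ∀ i, 0 ≤ u i
  eigen : u ᵥ* R = u
  sum_eq : ∑ i, u i = n

/-- `v` is a nonnegative right eigenvector of `C` for the eigenvalue `1`, with `1ᵀ v = n`. -/
structure IsRightPerron {n : ℕ} (C : Matrix (Fin n) (Fin n) ℝ) (v : Fin n → ℝ) : Prop where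
  nonneg : ∀ i, 0 ≤ v i
  eigen : C *ᵥ v = v
  sum_eq : ∑ i, v i = n

/-- The rank-one matrix `1 uᵀ / n`. -/
def projR {n : ℕ} (u : Fin n → ℝ) : Matrix (Fin n) (Fin n) ℝ := Matrix.of fun _ j => u j / n

/-- The rank-one matrix `v 1ᵀ / n`. -/
def projC {n : ℕ} (v : Fin n → ℝ) : Matrix (Fin n) (Fin n) ℝ := Matrix.of fun i _ => v i / n

/-! ### Norms -/

/-- The Euclidean norm of a vector of `ℝⁿ`. -/
def norm2 {n : ℕ} (w : Fin n → ℝ) : ℝ := ‖WithLp.toLp 2 w‖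

/-- The spectral norm of a square matrix. -/
def matNorm2 {n : ℕ} (W : Matrix (Fin n) (Fin n) ℝ) : ℝ := ‖Matrix.toEuclideanCLM (𝕜 := ℝ) W‖

/-- The matrix norm induced by a vector norm `N` on `ℝⁿ`. -/
def matNorm {n : ℕ} (N : Seminorm ℝ (Fin n → ℝ)) (W : Matrix (Fin n) (Fin n) ℝ) : ℝ :=
  sInf {c : ℝ | 0 ≤ c ∧ ∀ w, N (W *ᵥ w) ≤ c * N w}

/-- The extension of a norm `N` on `ℝⁿ` to `ℝ^{n × p}`: the Euclidean norm of the vector of the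
norms of the columns. The matrix is given by its `n` rows. -/
def stackNorm {n p : ℕ} (N : Seminorm ℝ (Fin n → ℝ)) (x : Fin n → EuclideanSpace ℝ (Fin p)) : ℝ :=
  √(∑ j, (N fun i => x i j) ^ 2)

/-- The requirements on the norms used in the analysis: `N` dominates the Euclidean norm (so it is
a norm and not only a seminorm), its induced matrix norm agrees with the spectral norm on diagonal
matrices, and `B` is a strict contraction for it. -/
structure IsContractionNorm {n : ℕ} (B : Matrix (Fin n) (Fin n) ℝ)
    (N : Seminorm ℝ (Fin n → ℝ)) : Prop where
  norm2_le : ∀ w, norm2 w ≤ N w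
  diagonal : ∀ d : Fin n → ℝ, matNorm N (Matrix.diagonal d) = matNorm2 (Matrix.diagonal d)
  contraction : matNorm N B < 1

/-! ### The algorithm -/

/-- `(x, y)` is generated by the Push-Pull method with step sizes `α`, from an arbitrary `x 0`. -/
structure IsTrajectory {n p : ℕ} (f : Fin n → EuclideanSpace ℝ (Fin p) → ℝ)
    (R C : Matrix (Fin n) (Fin n) ℝ) (α : Fin n → ℝ)
    (x y : ℕ → Fin n → EuclideanSpace ℝ (Fin p)) : Prop where
  init : ∀ i, y 0 i = gradient (f i) (x 0 i)
  step_x : ∀ k i, x (k + 1) i = ∑ j, R i j • (x k j - α j • y k j)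
  step_y : ∀ k i, y (k + 1) i =
    ∑ j, C i j • y k j + gradient (f i) (x (k + 1) i) - gradient (f i) (x k i)

/-- The weighted average `(1/n) wᵀ z` of the rows of `z`. -/
def avg {n p : ℕ} (w : Fin n → ℝ) (z : Fin n → EuclideanSpace ℝ (Fin p)) :
    EuclideanSpace ℝ (Fin p) := (n : ℝ)⁻¹ • ∑ i, w i • z i

/-! ### The constants -/

/-- `α̂ = maxᵢ αᵢ`. -/
def alphaHat {n : ℕ} (α : Fin n → ℝ) : ℝ := ⨆ i, α i

/-- `α' = uᵀ diag(α) v / n`. -/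
def alphaPrime {n : ℕ} (u v α : Fin n → ℝ) : ℝ := (∑ i, u i * α i * v i) / n

/-- `σ_R = ‖R - 1 uᵀ / n‖_R`. -/
def sigmaR {n : ℕ} (NR : Seminorm ℝ (Fin n → ℝ)) (R : Matrix (Fin n) (Fin n) ℝ)
    (u : Fin n → ℝ) : ℝ := matNorm NR (R - projR u)

/-- `σ_C = ‖C - v 1ᵀ / n‖_C`. -/
def sigmaC {n : ℕ} (NC : Seminorm ℝ (Fin n → ℝ)) (C : Matrix (Fin n) (Fin n) ℝ)
    (v : Fin n → ℝ) : ℝ := matNorm NC (C - projC v)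

/-- `c₀ = ‖I - v 1ᵀ / n‖_C`. -/
def c0 {n : ℕ} (NC : Seminorm ℝ (Fin n → ℝ)) (v : Fin n → ℝ) : ℝ := matNorm NC (1 - projC v)

/-- The `3 × 3` transition matrix `A`; `δC2` and `δRC` are the norm comparison constants. -/
def transition {n : ℕ} (μ L : ℝ) (R C : Matrix (Fin n) (Fin n) ℝ) (u v α : Fin n → ℝ)
    (NR NC : Seminorm ℝ (Fin n → ℝ)) (δC2 δRC : ℝ) : Matrix (Fin 3) (Fin 3) ℝ :=
  !![1 - alphaPrime u v α * μ,
      alphaPrime u v α * L / √n,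
      alphaHat α * norm2 u / n;
    alphaHat α * sigmaR NR R u * NR v * L,
      sigmaR NR R u * (1 + alphaHat α * NR v * (L / √n)),
      alphaHat α * sigmaR NR R u * δRC;
    alphaHat α * c0 NC v * δC2 * matNorm2 R * norm2 v * L ^ 2,
      c0 NC v * δC2 * L * (matNorm2 (R - 1) + alphaHat α * matNorm2 R * norm2 v * (L / √n)),
      sigmaC NC C v + alphaHat α * c0 NC v * δC2 * matNorm2 R * L]

def c1 {n : ℕ} (μ L M : ℝ) (R : Matrix (Fin n) (Fin n) ℝ) (u v : Fin n → ℝ)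
    (NR NC : Seminorm ℝ (Fin n → ℝ)) (δC2 δRC : ℝ) : ℝ :=
  sigmaR NR R u * c0 NC v * δC2 * matNorm2 R * norm2 v * (L ^ 2 / (n * √n)) *
    (M * δRC * n * (L + μ) + norm2 u * NR v * L)

def c2 {n : ℕ} (μ L M : ℝ) (R C : Matrix (Fin n) (Fin n) ℝ) (u v : Fin n → ℝ)
    (NR NC : Seminorm ℝ (Fin n → ℝ)) (δC2 δRC : ℝ) : ℝ :=
  sigmaR NR R u * c0 NC v * δC2 * norm2 u * NR v * matNorm2 (R - 1) * (L ^ 2 / n)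
  + c0 NC v * δC2 * matNorm2 R * norm2 v * norm2 u * (1 - sigmaR NR R u) * (L ^ 2 / (2 * n))
  + M * sigmaR NR R u * c0 NC v * δRC * δC2 * matNorm2 (R - 1) * μ * L
  + M / 2 * sigmaR NR R u * NR v * (1 - sigmaC NC C v) * (L ^ 2 / √n)

def c3 {n : ℕ} (μ M : ℝ) (R C : Matrix (Fin n) (Fin n) ℝ) (u v : Fin n → ℝ)
    (NR NC : Seminorm ℝ (Fin n → ℝ)) : ℝ :=
  M / 4 * (1 - sigmaC NC C v) * (1 - sigmaR NR R u) * μ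

/-- The step size bound `2 c₃ / (c₂ + √(c₂² + 4 c₁ c₃))`. -/
def stepBound {n : ℕ} (μ L M : ℝ) (R C : Matrix (Fin n) (Fin n) ℝ) (u v : Fin n → ℝ)
    (NR NC : Seminorm ℝ (Fin n → ℝ)) (δC2 δRC : ℝ) : ℝ :=
  2 * c3 μ M R C u v NR NC /
    (c2 μ L M R C u v NR NC δC2 δRC +
      √(c2 μ L M R C u v NR NC δC2 δRC ^ 2 +
        4 * c1 μ L M R u v NR NC δC2 δRC * c3 μ M R C u v NR NC))

/-- The spectral radius of a real matrix: the largest modulus of its complex eigenvalues. -/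
def specRad {m : ℕ} (A : Matrix (Fin m) (Fin m) ℝ) : ℝ :=
  (spectralRadius ℂ (A.map (algebraMap ℝ ℂ))).toReal

end

end PushPull

namespace PushPull

/-! ### The Euclidean norm and induced matrix norms -/

/-! Three errors are followed: the distance of the `u`-average x̄ from the minimizer, the consensus
error of x, and the deviation of y from v ȳ. As C has unit column sums and y starts at the local
gradients, ȳ is always the average of the local gradients (`IsTrajectory.avg_y`). So x̄ makes a
gradient step of length α' on the average objective, perturbed by the other two errors, which are
themselves contracted by R − 1uᵀ/n and C − v1ᵀ/n up to coupling terms. This gives z (k+1) ≤ A z k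
entrywise (`IsTrajectory.errors_succ_le`). The factor 1 − α'μ of the gradient step needs α' to be
small; α'L² ≤ μ is extracted from the step size condition (`step_size_average`) with a few a priori
inequalities between the constants, such as 1 − σ_R ≤ ‖R − I‖₂.

Since A is nonnegative, ρ(A) < 1 follows from a positive w with A w < w. If the diagonal entries are
below 1 and det(I − A) > 0, the row sums of the adjugate of I − A form such a w
(`exists_pos_mulVec_lt`). The first step size bound is the positive root of c₁a² + c₂a = c₃, and
a(c₃ − c₂a − c₁a²) bounds the determinant from below (`step_size_det`).

To get the rate ρ(A)^k without loss, a positive eigenvector of A (`exists_pos_eigenvector`) is used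
to dominate the errors. If σ_R = 0 the middle row of A vanishes and the argument is run on the
remaining 2 × 2 system (`isBigO_of_recursion_three`).

For the existence of norms, the difficulty is that u may vanish at some nodes. On its support a
variance identity (`IsLeftPerron.variance`) and compactness give a contraction in the u-weighted
Euclidean seminorm; off the support R leaks mass, and a suitable weight
(`IsLeftPerron.exists_weight`) makes it a contraction in a weighted sup seminorm. The matrix is
block triangular, so a combination K p + q works. It is monotone, which settles the condition on
diagonal matrices. For C the dual of a norm built for Cᵀ is taken. -/

lemma norm2_sq {n : ℕ} (w : Fin n → ℝ) : norm2 w ^ 2 = ∑ i, w i ^ 2 := by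
  simp [norm2, EuclideanSpace.norm_sq_eq]

lemma norm2_nonneg {n : ℕ} (w : Fin n → ℝ) : 0 ≤ norm2 w := norm_nonneg _

lemma norm2_eq_zero {n : ℕ} {w : Fin n → ℝ} : norm2 w = 0 ↔ w = 0 := by
  simp [norm2]

lemma norm2_one_sq {n : ℕ} : norm2 (1 : Fin n → ℝ) ^ 2 = n := by
  simp [norm2_sq]

lemma abs_apply_le_norm2 {n : ℕ} (w : Fin n → ℝ) (i : Fin n) : |w i| ≤ norm2 w := by
  refine abs_le_of_sq_le_sq ?_ (norm2_nonneg w)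
  rw [norm2_sq]
  exact Finset.single_le_sum (f := fun i => w i ^ 2) (fun _ _ => sq_nonneg _) (Finset.mem_univ i)

lemma dotProduct_le_norm2 {n : ℕ} (w z : Fin n → ℝ) : w ⬝ᵥ z ≤ norm2 w * norm2 z := by
  have h := real_inner_le_norm (WithLp.toLp 2 z) (WithLp.toLp 2 w)
  rw [EuclideanSpace.inner_toLp_toLp] at h
  rw [mul_comm]
  simpa [norm2] using h

/-- The Euclidean norm as a seminorm on `Fin n → ℝ`. -/
noncomputable def euclideanSeminorm (n : ℕ) : Seminorm ℝ (Fin n → ℝ) :=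
  (normSeminorm ℝ (EuclideanSpace ℝ (Fin n))).comp
    (WithLp.linearEquiv 2 ℝ (Fin n → ℝ)).symm.toLinearMap

@[simp] lemma euclideanSeminorm_apply {n : ℕ} (w : Fin n → ℝ) :
    euclideanSeminorm n w = norm2 w := rfl

lemma norm2_mulVec_le {n : ℕ} (W : Matrix (Fin n) (Fin n) ℝ) (w : Fin n → ℝ) :
    norm2 (W *ᵥ w) ≤ matNorm2 W * norm2 w := by
  have h := (Matrix.toEuclideanCLM (𝕜 := ℝ) W).le_opNorm (WithLp.toLp 2 w)
  rwa [Matrix.toEuclideanCLM_toLp] at h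

lemma matNorm2_nonneg {n : ℕ} (W : Matrix (Fin n) (Fin n) ℝ) : 0 ≤ matNorm2 W := norm_nonneg _

lemma exists_seminorm_le {n : ℕ} (N : Seminorm ℝ (Fin n → ℝ)) :
    ∃ K, 0 < K ∧ ∀ w, N w ≤ K * norm2 w := by
  -- The summand 1 keeps the constant positive when `N` vanishes.
  refine ⟨∑ i, N (Pi.single i 1) + 1,
    add_pos_of_nonneg_of_pos (Finset.sum_nonneg fun _ _ => apply_nonneg _ _) one_pos, fun w => ?_⟩
  have h : N w ≤ ∑ i, |w i| * N (Pi.single i 1) := by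
    have hw : w = ∑ i, w i • (Pi.single i 1 : Fin n → ℝ) := by
      ext j; simp [Finset.sum_apply, Pi.single_apply]
    conv_lhs => rw [hw]
    refine (Finset.le_sum_of_subadditive N (map_zero N).le (map_add_le_add N) _ _).trans (Finset.sum_le_sum fun i _ => ?_)
    rw [map_smul_eq_mul, Real.norm_eq_abs]
  refine h.trans ?_
  rw [add_mul, Finset.sum_mul]
  refine le_add_of_le_of_nonneg (Finset.sum_le_sum fun i _ => ?_) (by simp [norm2_nonneg])
  rw [mul_comm]
  exact mul_le_mul_of_nonneg_left (abs_apply_le_norm2 w i) (apply_nonneg _ _)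

lemma matNorm_nonneg {n : ℕ} (N : Seminorm ℝ (Fin n → ℝ)) (W : Matrix (Fin n) (Fin n) ℝ) :
    0 ≤ matNorm N W := Real.sInf_nonneg fun _ h => h.1

lemma matNorm_le {n : ℕ} {N : Seminorm ℝ (Fin n → ℝ)} {W : Matrix (Fin n) (Fin n) ℝ} {c : ℝ}
    (hc : 0 ≤ c) (h : ∀ w, N (W *ᵥ w) ≤ c * N w) : matNorm N W ≤ c :=
  csInf_le ⟨0, fun _ h => h.1⟩ ⟨hc, h⟩

/-- The infimum in `matNorm` could be over the empty set for a degenerate seminorm. Domination of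
the Euclidean norm excludes this, and it also settles N w = 0, where w must be 0. -/
lemma apply_mulVec_le {n : ℕ} {N : Seminorm ℝ (Fin n → ℝ)} (hN : ∀ w, norm2 w ≤ N w)
    (W : Matrix (Fin n) (Fin n) ℝ) (w : Fin n → ℝ) : N (W *ᵥ w) ≤ matNorm N W * N w := by
  rcases (apply_nonneg N w).eq_or_lt with h0 | h0
  · have : w = 0 := norm2_eq_zero.1 (le_antisymm (h0 ▸ hN w) (norm2_nonneg w))
    simp [this]
  · rw [← div_le_iff₀ h0]
    obtain ⟨K, hK, hKN⟩ := exists_seminorm_le N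
    refine le_csInf ⟨K * matNorm2 W, by positivity [matNorm2_nonneg W], fun z => ?_⟩ ?_
    · refine (hKN _).trans ?_
      rw [mul_assoc]
      gcongr
      exact (norm2_mulVec_le W z).trans (mul_le_mul_of_nonneg_left (hN z) (matNorm2_nonneg W))
    · rintro c ⟨-, hc⟩
      exact (div_le_iff₀ h0).2 (hc w)

lemma matNorm_euclidean {n : ℕ} (W : Matrix (Fin n) (Fin n) ℝ) :
    matNorm (euclideanSeminorm n) W = matNorm2 W := by
  refine le_antisymm (matNorm_le (matNorm2_nonneg W) (norm2_mulVec_le W)) ?_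
  refine ContinuousLinearMap.opNorm_le_bound _ (matNorm_nonneg _ _) fun z => ?_
  have h := apply_mulVec_le (N := euclideanSeminorm n) (fun _ => le_rfl) W (WithLp.ofLp z)
  simp only [euclideanSeminorm_apply, norm2] at h
  rwa [← Matrix.toEuclideanCLM_toLp] at h

/-- A seminorm is monotone if it depends monotonically on the absolute values of the entries. -/
def IsMonotone {n : ℕ} (N : Seminorm ℝ (Fin n → ℝ)) : Prop :=
  ∀ w z, (∀ i, |w i| ≤ |z i|) → N w ≤ N z

lemma isMonotone_euclidean (n : ℕ) : IsMonotone (euclideanSeminorm n) := fun w z h => by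
  simp only [euclideanSeminorm_apply]
  refine le_of_sq_le_sq ?_ (norm2_nonneg z)
  rw [norm2_sq, norm2_sq]
  exact Finset.sum_le_sum fun i _ => sq_le_sq.2 (h i)

/-- Monotonicity gives the upper bound and the basis vectors give the lower one. The value does not
depend on `N`, so every monotone norm agrees with the spectral norm on diagonal matrices. -/
lemma matNorm_diagonal {n : ℕ} {N : Seminorm ℝ (Fin n → ℝ)} (hN : ∀ w, norm2 w ≤ N w)
    (hmono : IsMonotone N) (d : Fin n → ℝ) : matNorm N (diagonal d) = ‖d‖ := by
  refine le_antisymm (matNorm_le (norm_nonneg _) fun w => ?_) ?_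
  · have : N (‖d‖ • w) = ‖d‖ * N w := by rw [map_smul_eq_mul, norm_norm]
    rw [← this]
    refine hmono _ _ fun i => ?_
    simp only [mulVec_diagonal, Pi.smul_apply, smul_eq_mul, abs_mul, abs_norm]
    exact mul_le_mul_of_nonneg_right (norm_le_pi_norm d i) (abs_nonneg _)
  · refine (pi_norm_le_iff_of_nonneg (matNorm_nonneg _ _)).2 fun i => ?_
    have h := apply_mulVec_le hN (diagonal d) (Pi.single i 1)
    have hs : diagonal d *ᵥ Pi.single i 1 = d i • (Pi.single i 1 : Fin n → ℝ) := by
      ext j; rcases eq_or_ne j i with rfl | hj <;> simp [mulVec_diagonal, *]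
    rw [hs, map_smul_eq_mul] at h
    refine le_of_mul_le_mul_right h (lt_of_lt_of_le ?_ (hN _))
    exact lt_of_lt_of_le (by simp) (abs_apply_le_norm2 (Pi.single i 1) i)

lemma matNorm_diagonal_eq {n : ℕ} {N : Seminorm ℝ (Fin n → ℝ)} (hN : ∀ w, norm2 w ≤ N w)
    (hmono : IsMonotone N) (d : Fin n → ℝ) :
    matNorm N (diagonal d) = matNorm2 (diagonal d) := by
  rw [matNorm_diagonal hN hmono, ← matNorm_euclidean,
    matNorm_diagonal (fun _ => le_rfl) (isMonotone_euclidean n)]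

lemma matNorm2_diagonal {n : ℕ} (d : Fin n → ℝ) : matNorm2 (diagonal d) = ‖d‖ := by
  rw [← matNorm_euclidean, matNorm_diagonal (fun _ => le_rfl) (isMonotone_euclidean n)]

/-! ### Stacked norms -/

/-- The product of a matrix with a stack of row vectors. -/
noncomputable def mulRows {n p : ℕ} (W : Matrix (Fin n) (Fin n) ℝ)
    (x : Fin n → EuclideanSpace ℝ (Fin p)) : Fin n → EuclideanSpace ℝ (Fin p) :=
  fun i => ∑ j, W i j • x j

lemma stackNorm_nonneg {n p : ℕ} (N : Seminorm ℝ (Fin n → ℝ))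
    (x : Fin n → EuclideanSpace ℝ (Fin p)) : 0 ≤ stackNorm N x := Real.sqrt_nonneg _

lemma stackNorm_eq_norm2 {n p : ℕ} (N : Seminorm ℝ (Fin n → ℝ))
    (x : Fin n → EuclideanSpace ℝ (Fin p)) :
    stackNorm N x = norm2 fun j => N fun i => x i j := by
  rw [stackNorm, ← norm2_sq, Real.sqrt_sq (norm2_nonneg _)]

lemma norm2_le_of_abs_le {n : ℕ} {w z : Fin n → ℝ} (h : ∀ i, |w i| ≤ |z i|) :
    norm2 w ≤ norm2 z := isMonotone_euclidean n w z h

lemma norm2_add_le {n : ℕ} (w z : Fin n → ℝ) : norm2 (w + z) ≤ norm2 w + norm2 z :=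
  map_add_le_add (euclideanSeminorm n) w z

lemma norm2_smul {n : ℕ} (c : ℝ) (w : Fin n → ℝ) : norm2 (c • w) = |c| * norm2 w :=
  map_smul_eq_mul (euclideanSeminorm n) c w

lemma stackNorm_add_le {n p : ℕ} (N : Seminorm ℝ (Fin n → ℝ))
    (x y : Fin n → EuclideanSpace ℝ (Fin p)) :
    stackNorm N (x + y) ≤ stackNorm N x + stackNorm N y := by
  simp only [stackNorm_eq_norm2]
  refine le_trans (norm2_le_of_abs_le fun j => ?_) (norm2_add_le _ _)
  simp only [Pi.add_apply, PiLp.add_apply]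
  rw [abs_of_nonneg (apply_nonneg _ _),
    abs_of_nonneg (add_nonneg (apply_nonneg _ _) (apply_nonneg _ _))]
  exact map_add_le_add N (fun i => x i j) (fun i => y i j)

lemma stackNorm_neg {n p : ℕ} (N : Seminorm ℝ (Fin n → ℝ))
    (x : Fin n → EuclideanSpace ℝ (Fin p)) : stackNorm N (-x) = stackNorm N x := by
  simp only [stackNorm_eq_norm2]
  congr 1
  ext j
  exact map_neg_eq_map N (fun i => x i j)

lemma stackNorm_sub_le {n p : ℕ} (N : Seminorm ℝ (Fin n → ℝ))
    (x y : Fin n → EuclideanSpace ℝ (Fin p)) :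
    stackNorm N (x - y) ≤ stackNorm N x + stackNorm N y := by
  rw [sub_eq_add_neg, ← stackNorm_neg N y]
  exact stackNorm_add_le N x (-y)

lemma stackNorm_le_of_columns {n m p : ℕ} {N : Seminorm ℝ (Fin n → ℝ)}
    {N' : Seminorm ℝ (Fin m → ℝ)} {x : Fin n → EuclideanSpace ℝ (Fin p)}
    {y : Fin m → EuclideanSpace ℝ (Fin p)} {c : ℝ} (hc : 0 ≤ c)
    (h : ∀ j, N (fun i => x i j) ≤ c * N' (fun i => y i j)) :
    stackNorm N x ≤ c * stackNorm N' y := by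
  simp only [stackNorm_eq_norm2]
  rw [← abs_of_nonneg hc, ← norm2_smul]
  refine norm2_le_of_abs_le fun j => ?_
  simp only [Pi.smul_apply, smul_eq_mul]
  rw [abs_of_nonneg (apply_nonneg _ _), abs_of_nonneg (mul_nonneg hc (apply_nonneg _ _))]
  exact h j

lemma stackNorm_mulRows_le {n p : ℕ} {N : Seminorm ℝ (Fin n → ℝ)} (hN : ∀ w, norm2 w ≤ N w)
    (W : Matrix (Fin n) (Fin n) ℝ) (x : Fin n → EuclideanSpace ℝ (Fin p)) :
    stackNorm N (mulRows W x) ≤ matNorm N W * stackNorm N x := by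
  refine stackNorm_le_of_columns (matNorm_nonneg _ _) fun j => ?_
  convert apply_mulVec_le hN W fun i => x i j using 2
  ext i
  simp [mulRows, mulVec, dotProduct]

lemma stackNorm_rankOne {n p : ℕ} (N : Seminorm ℝ (Fin n → ℝ)) (v : Fin n → ℝ)
    (a : EuclideanSpace ℝ (Fin p)) : stackNorm N (fun i => v i • a) = N v * ‖a‖ := by
  have h : (fun j => N fun i => (v i • a) j) = N v • fun j => |a j| := by
    ext j
    have : (fun i => (v i • a) j) = a j • v := by ext i; simp [mul_comm]
    rw [this, map_smul_eq_mul]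
    simp [mul_comm]
  rw [stackNorm_eq_norm2, h, norm2_smul, abs_of_nonneg (apply_nonneg _ _)]
  congr 1
  rw [← abs_of_nonneg (norm2_nonneg _), ← abs_of_nonneg (norm_nonneg a), ← sq_eq_sq_iff_abs_eq_abs,
    norm2_sq, EuclideanSpace.norm_sq_eq]
  simp

/-- For the Euclidean norm the stack norm is the Frobenius norm, so it can be computed by rows; this
is how the rowwise Lipschitz bounds on the gradients enter. -/
lemma stackNorm_euclidean_sq {n p : ℕ} (x : Fin n → EuclideanSpace ℝ (Fin p)) :
    stackNorm (euclideanSeminorm n) x ^ 2 = ∑ i, ‖x i‖ ^ 2 := by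
  rw [stackNorm_eq_norm2, norm2_sq]
  simp only [euclideanSeminorm_apply, norm2_sq, EuclideanSpace.norm_sq_eq, Real.norm_eq_abs, sq_abs]
  exact Finset.sum_comm

lemma stackNorm_euclidean_eq {n p : ℕ} (x : Fin n → EuclideanSpace ℝ (Fin p)) :
    stackNorm (euclideanSeminorm n) x = norm2 fun i => ‖x i‖ := by
  rw [← sq_eq_sq₀ (stackNorm_nonneg _ _) (norm2_nonneg _), stackNorm_euclidean_sq, norm2_sq]

lemma norm_weighted_sum_le {n p : ℕ} (w : Fin n → ℝ) (x : Fin n → EuclideanSpace ℝ (Fin p)) :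
    ‖∑ i, w i • x i‖ ≤ norm2 w * stackNorm (euclideanSeminorm n) x := by
  rw [stackNorm_euclidean_eq]
  have h1 : norm2 w = norm2 fun i => |w i| := by
    rw [← sq_eq_sq₀ (norm2_nonneg _) (norm2_nonneg _), norm2_sq, norm2_sq]; simp
  rw [h1]
  refine (norm_sum_le _ _).trans (le_trans (le_of_eq ?_) (dotProduct_le_norm2 _ _))
  simp [dotProduct, norm_smul]

/-! ### Existence of contraction norms -/

lemma mulVec_apply_eq_sum {n : ℕ} (W : Matrix (Fin n) (Fin n) ℝ) (x : Fin n → ℝ) (i : Fin n) :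
    (W *ᵥ x) i = ∑ j, W i j * x j := rfl

/-! ### The support of the Perron vector, and contraction on and off it. -/

section Perron

variable {n : ℕ} {R : Matrix (Fin n) (Fin n) ℝ} {u : Fin n → ℝ}

lemma IsLeftPerron.eigen_apply (hu : IsLeftPerron R u) (j : Fin n) :
    ∑ i, u i * R i j = u j := congr_fun hu.eigen j

/-- A vanishing sum of nonnegative terms. Thus rows of R indexed by the support of u have no entries
in columns off the support: R is block triangular. -/
lemma IsLeftPerron.mul_apply_eq_zero (hR : ∀ i j, 0 ≤ R i j) (hu : IsLeftPerron R u) {j : Fin n}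
    (hj : u j = 0) (i : Fin n) : u i * R i j = 0 := by
  have h := hu.eigen_apply j
  rw [hj, Finset.sum_eq_zero_iff_of_nonneg fun i _ => mul_nonneg (hu.nonneg i) (hR i j)] at h
  exact h i (Finset.mem_univ i)

lemma IsLeftPerron.pos_of_edge (hR : ∀ i j, 0 ≤ R i j) (hu : IsLeftPerron R u) {i j : Fin n}
    (hi : 0 < u i) (hij : 0 < R i j) : 0 < u j := by
  refine (hu.nonneg j).lt_of_ne fun h => ?_
  exact (mul_pos hi hij).ne' (hu.mul_apply_eq_zero hR h.symm i)

lemma IsLeftPerron.pos_of_reach (hR : ∀ i j, 0 ≤ R i j) (hu : IsLeftPerron R u) {r i : Fin n}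
    (h : Relation.ReflTransGen (inducedEdge R) r i) (hi : 0 < u i) : 0 < u r := by
  induction h with
  | refl => exact hi
  | tail _ hbc ih => exact ih (hu.pos_of_edge hR hi hbc)

lemma IsLeftPerron.pos_root (hR : ∀ i j, 0 ≤ R i j) (hu : IsLeftPerron R u) (hn : 0 < n)
    {r : Fin n} (hr : ∀ i, Relation.ReflTransGen (inducedEdge R) r i) : 0 < u r := by
  obtain ⟨i, hi⟩ : ∃ i, 0 < u i := by
    by_contra! h
    have h0 : ∑ i, u i = 0 := Finset.sum_eq_zero fun i _ => le_antisymm (h i) (hu.nonneg i)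
    rw [hu.sum_eq] at h0
    exact hn.ne' (by exact_mod_cast h0)
  exact hu.pos_of_reach hR (hr i) hi

lemma sub_projR_mulVec_apply (x : Fin n → ℝ) (i : Fin n) :
    ((R - projR u) *ᵥ x) i = (R *ᵥ x) i - (∑ j, u j * x j) / n := by
  rw [sub_mulVec, Pi.sub_apply, mulVec_apply_eq_sum (projR u), Finset.sum_div]
  congr 1
  exact Finset.sum_congr rfl fun j _ => by rw [projR, of_apply]; ring

lemma IsLeftPerron.sum_mulVec (hu : IsLeftPerron R u) (x : Fin n → ℝ) :
    ∑ i, u i * (R *ᵥ x) i = ∑ j, u j * x j := by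
  have h := dotProduct_mulVec u R x
  rw [hu.eigen] at h
  exact h

/-- Row i of R is a probability vector, so the inner sum is the variance of x under it. Averaging
over the invariant weight u turns the mean of squares back into the weighted square sum; subtracting
the projection removes the squared mean as well. -/
lemma IsLeftPerron.variance (hR : ∀ i, ∑ j, R i j = 1) (hu : IsLeftPerron R u) (hn : 0 < n)
    (x : Fin n → ℝ) :
    ∑ i, u i * x i ^ 2 - ∑ i, u i * ((R - projR u) *ᵥ x) i ^ 2 =
      ∑ i, u i * ∑ j, R i j * (x j - (R *ᵥ x) i) ^ 2 + (∑ j, u j * x j) ^ 2 / n := by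
  have hn' : (n : ℝ) ≠ 0 := by exact_mod_cast hn.ne'
  set m := ∑ j, u j * x j with hm
  have h1 : ∀ i, ∑ j, R i j * (x j - (R *ᵥ x) i) ^ 2 =
      (R *ᵥ fun j => x j ^ 2) i - (R *ᵥ x) i ^ 2 := fun i => by
    have e : ∀ j, R i j * (x j - (R *ᵥ x) i) ^ 2 = R i j * x j ^ 2
        - 2 * (R *ᵥ x) i * (R i j * x j) + (R *ᵥ x) i ^ 2 * R i j := fun j => by ring
    simp_rw [e, Finset.sum_add_distrib, Finset.sum_sub_distrib, ← Finset.mul_sum, hR i]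
    have e2 : ∑ j, R i j * x j = (R *ᵥ x) i := rfl
    have e3 : ∑ j, R i j * x j ^ 2 = (R *ᵥ fun j => x j ^ 2) i := rfl
    rw [e2, e3]; ring
  have h2 : ∑ i, u i * ((R - projR u) *ᵥ x) i ^ 2 =
      ∑ i, u i * (R *ᵥ x) i ^ 2 - m ^ 2 / n := by
    have e : ∀ i, u i * ((R - projR u) *ᵥ x) i ^ 2 = u i * (R *ᵥ x) i ^ 2
        - 2 * (m / n) * (u i * (R *ᵥ x) i) + (m / n) ^ 2 * u i := fun i => by
      rw [sub_projR_mulVec_apply, ← hm]; ring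
    simp_rw [e, Finset.sum_add_distrib, Finset.sum_sub_distrib, ← Finset.mul_sum, hu.sum_mulVec,
      hu.sum_eq, ← hm]
    field_simp
    ring
  have h3 := hu.sum_mulVec fun j => x j ^ 2
  simp_rw [h1, h2, mul_sub, Finset.sum_sub_distrib, h3]
  ring

/-- Without strict decrease all variances at support nodes vanish. The positive diagonal then makes
x equal at both ends of each edge into the support, so x is constant there, with the value at the
root; the vanishing u-mean forces this constant to be 0. -/
lemma IsLeftPerron.weighted_lt (hR0 : ∀ i j, 0 ≤ R i j) (hR : ∀ i, ∑ j, R i j = 1)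
    (hd : ∀ i, 0 < R i i) (hu : IsLeftPerron R u) (hn : 0 < n)
    {r : Fin n} (hr : ∀ i, Relation.ReflTransGen (inducedEdge R) r i) {x : Fin n → ℝ}
    (hx : 0 < ∑ i, u i * x i ^ 2) :
    ∑ i, u i * ((R - projR u) *ᵥ x) i ^ 2 < ∑ i, u i * x i ^ 2 := by
  have hn' : (0 : ℝ) < n := by exact_mod_cast hn
  rw [← sub_pos, hu.variance hR hn]
  have hnn : ∀ i j, 0 ≤ R i j * (x j - (R *ᵥ x) i) ^ 2 := fun i j =>
    mul_nonneg (hR0 i j) (sq_nonneg _)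
  have hnn' : ∀ i, 0 ≤ u i * ∑ j, R i j * (x j - (R *ᵥ x) i) ^ 2 := fun i =>
    mul_nonneg (hu.nonneg i) (Finset.sum_nonneg fun j _ => hnn i j)
  have hs := Finset.sum_nonneg fun i (_ : i ∈ Finset.univ) => hnn' i
  have hm : 0 ≤ (∑ j, u j * x j) ^ 2 / n := by positivity
  refine (add_nonneg hs hm).lt_of_ne fun h0 => ?_
  have hs0 := (add_eq_zero_iff_of_nonneg hs hm).1 h0.symm
  have hedge : ∀ i j, 0 < u i → 0 < R i j → x j = (R *ᵥ x) i := fun i j hi hij => by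
    have h1 := (Finset.sum_eq_zero_iff_of_nonneg fun i _ => hnn' i).1 hs0.1 i (Finset.mem_univ i)
    have h2 := (mul_eq_zero.1 h1).resolve_left hi.ne'
    have h3 := (Finset.sum_eq_zero_iff_of_nonneg fun j _ => hnn i j).1 h2 j (Finset.mem_univ j)
    exact sub_eq_zero.1 (pow_eq_zero_iff two_ne_zero |>.1 ((mul_eq_zero.1 h3).resolve_left hij.ne'))
  have hconst : ∀ i, 0 < u i → x i = x r := fun i hi => by
    have h := hr i
    induction h with
    | refl => rfl
    | tail _ hbc ih =>
      rw [← ih (hu.pos_of_edge hR0 hi hbc), hedge _ _ hi hbc, hedge _ _ hi (hd _)]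
  have hux : ∀ i, u i * x i = u i * x r := fun i => by
    rcases (hu.nonneg i).eq_or_lt with h | h
    · simp [← h]
    · rw [hconst i h]
  have hxr : x r = 0 := by
    have h := hs0.2
    simp_rw [hux, ← Finset.sum_mul, hu.sum_eq] at h
    simpa [hn'.ne'] using h
  refine hx.ne' (Finset.sum_eq_zero fun i _ => ?_)
  rw [pow_two, ← mul_assoc, hux, hxr]; ring

/-- Compactness makes the strict decrease uniform. The form q is degenerate off the support of u, so
the unit sphere is taken only among vectors that vanish there. -/
lemma IsLeftPerron.exists_weighted_contraction (hR0 : ∀ i j, 0 ≤ R i j)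
    (hR : ∀ i, ∑ j, R i j = 1) (hd : ∀ i, 0 < R i i) (hu : IsLeftPerron R u) (hn : 0 < n)
    {r : Fin n} (hr : ∀ i, Relation.ReflTransGen (inducedEdge R) r i) :
    ∃ ρ, 0 ≤ ρ ∧ ρ < 1 ∧ ∀ x : Fin n → ℝ,
      ∑ i, u i * ((R - projR u) *ᵥ x) i ^ 2 ≤ ρ * ∑ i, u i * x i ^ 2 := by
  set q : (Fin n → ℝ) → ℝ := fun x => ∑ i, u i * x i ^ 2 with hq
  set B := R - projR u with hB
  have hqnn : ∀ x, 0 ≤ q x := fun x =>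
    Finset.sum_nonneg fun i _ => mul_nonneg (hu.nonneg i) (sq_nonneg _)
  have hqc : Continuous q := by fun_prop
  have hBc : Continuous fun x : Fin n → ℝ => q (B *ᵥ x) :=
    hqc.comp (Continuous.matrix_mulVec continuous_const continuous_id)
  set S : Set (Fin n → ℝ) := {x | q x = 1 ∧ ∀ i, u i = 0 → x i = 0} with hS
  have hScl : IsClosed S := by
    have : S = {x | q x = 1} ∩ ⋂ i, {x | u i = 0 → x i = 0} := by ext; simp [hS]
    rw [this]
    refine (isClosed_eq hqc continuous_const).inter (isClosed_iInter fun i => ?_)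
    by_cases h : u i = 0
    · simpa [h] using isClosed_eq (continuous_apply i) continuous_const
    · simp [h]
  -- The bound 1 + 1/u i avoids a square root: x i ² ≤ 1/u i ≤ (1 + 1/u i)². Where u i = 0 the
  -- inverse is 0 and x i = 0.
  have hSb : S ⊆ Set.pi Set.univ fun i => Set.Icc (-(1 + (u i)⁻¹)) (1 + (u i)⁻¹) := by
    rintro x ⟨h1, h2⟩ i -
    rw [Set.mem_Icc, ← abs_le]
    rcases (hu.nonneg i).eq_or_lt with h | h
    · simp [h2 i h.symm, ← h]
    · have h3 : u i * x i ^ 2 ≤ 1 := h1 ▸ Finset.single_le_sum (f := fun i => u i * x i ^ 2)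
        (fun i _ => mul_nonneg (hu.nonneg i) (sq_nonneg _)) (Finset.mem_univ i)
      have hp : 0 < (u i)⁻¹ := inv_pos.2 h
      have h4 : x i ^ 2 ≤ (u i)⁻¹ := by
        rw [inv_eq_one_div, le_div_iff₀ h]; linarith
      refine abs_le_of_sq_le_sq ?_ (by positivity)
      nlinarith
  have hSc : IsCompact S :=
    (isCompact_univ_pi fun _ => isCompact_Icc).of_isClosed_subset hScl hSb
  obtain ⟨ρ, h0, h1, hρ⟩ : ∃ ρ, 0 ≤ ρ ∧ ρ < 1 ∧ ∀ x ∈ S, q (B *ᵥ x) ≤ ρ := by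
    rcases S.eq_empty_or_nonempty with he | hne
    · exact ⟨0, le_rfl, one_pos, by simp [he]⟩
    · obtain ⟨z, hz, hmax⟩ := hSc.exists_isMaxOn hne hBc.continuousOn
      refine ⟨q (B *ᵥ z), hqnn _, ?_, fun x hx => hmax hx⟩
      have := hu.weighted_lt hR0 hR hd hn hr (x := z) (one_pos.trans_eq hz.1.symm)
      exact this.trans_eq hz.1
  refine ⟨ρ, h0, h1, fun x => ?_⟩
  change q (B *ᵥ x) ≤ ρ * q x
  rcases (hqnn x).eq_or_lt with hx | hx
  · have h := hu.variance hR hn x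
    have hr0 : 0 ≤ ∑ i, u i * ∑ j, R i j * (x j - (R *ᵥ x) i) ^ 2 + (∑ j, u j * x j) ^ 2 / n :=
      add_nonneg (Finset.sum_nonneg fun i _ => mul_nonneg (hu.nonneg i)
        (Finset.sum_nonneg fun j _ => mul_nonneg (hR0 i j) (sq_nonneg _))) (by positivity)
    change q x - q (B *ᵥ x) = _ at h
    rw [← hx]
    linarith
  · set c := √(q x) with hc
    have hcp : 0 < c := Real.sqrt_pos.2 hx
    have hc2 : c ^ 2 = q x := Real.sq_sqrt hx.le
    -- Normalization and truncation to the support. Truncating changes neither the u-mean nor the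
    -- rows of R in the support, so q (B z) is just rescaled.
    set z : Fin n → ℝ := fun i => if u i = 0 then 0 else c⁻¹ * x i with hz
    have hz1 : ∀ i, u i * z i = u i * (c⁻¹ * x i) := fun i => by
      by_cases h : u i = 0 <;> simp [hz, h]
    have hzS : z ∈ S := by
      refine ⟨?_, fun i hi => by simp [hz, hi]⟩
      have : ∀ i, u i * z i ^ 2 = c⁻¹ ^ 2 * (u i * x i ^ 2) := fun i => by
        by_cases h : u i = 0
        · simp [h]
        · simp [hz, h]; ring
      change ∑ i, u i * z i ^ 2 = 1
      simp_rw [this, ← Finset.mul_sum]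
      change c⁻¹ ^ 2 * q x = 1
      rw [← hc2]; field_simp
    have hBz : ∀ i, u i ≠ 0 → (B *ᵥ z) i = c⁻¹ * (B *ᵥ x) i := fun i hi => by
      simp only [hB, sub_projR_mulVec_apply, mul_sub]
      congr 1
      · simp only [mulVec, dotProduct, Finset.mul_sum]
        refine Finset.sum_congr rfl fun j _ => ?_
        by_cases h : u j = 0
        · have := (mul_eq_zero.1 (hu.mul_apply_eq_zero hR0 h i)).resolve_left hi
          simp [this]
        · simp [hz, h]; ring
      · simp_rw [hz1, mul_div_assoc', Finset.mul_sum]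
        congr 1
        exact Finset.sum_congr rfl fun j _ => by ring
    have hqB : q (B *ᵥ z) = c⁻¹ ^ 2 * q (B *ᵥ x) := by
      simp only [hq, Finset.mul_sum]
      refine Finset.sum_congr rfl fun i _ => ?_
      by_cases h : u i = 0
      · simp [h]
      · rw [hBz i h]; ring
    have := hρ z hzS
    rw [hqB, inv_pow, hc2, inv_mul_le_iff₀ hx] at this
    linarith

/-- Off the support of `u` the matrix `R` is strictly substochastic up to a change of weights. -/
lemma IsLeftPerron.exists_weight (hR0 : ∀ i j, 0 ≤ R i j)
    (hR : ∀ i, ∑ j, R i j = 1) (hu : IsLeftPerron R u) (hn : 0 < n)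
    {r : Fin n} (hr : ∀ i, Relation.ReflTransGen (inducedEdge R) r i) :
    ∃ h : Fin n → ℝ, (∀ i, 0 < u i → h i = 0) ∧ (∀ i, u i = 0 → 0 < h i) ∧
      ∀ i, u i = 0 → (R *ᵥ h) i < h i := by
  -- G k i is the probability that the Markov chain with transition matrix R, started at i, is still
  -- off the support of u after k steps. The support is absorbing and reachable from every node, so
  -- G decreases in k and eventually drops below 1.
  set G : ℕ → Fin n → ℝ := fun k => (fun g => R *ᵥ g)^[k] (fun i => if u i = 0 then 1 else 0)
    with hG
  have hsucc : ∀ k, G (k + 1) = R *ᵥ G k := fun k => Function.iterate_succ_apply' _ _ _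
  have hmv : ∀ (g g' : Fin n → ℝ), (∀ i, g i ≤ g' i) → ∀ i, (R *ᵥ g) i ≤ (R *ᵥ g') i :=
    fun g g' h i => by
      rw [mulVec_apply_eq_sum, mulVec_apply_eq_sum]
      exact Finset.sum_le_sum fun j _ => mul_le_mul_of_nonneg_left (h j) (hR0 i j)
  have hG0 : ∀ k i, 0 ≤ G k i := fun k => by
    induction k with
    | zero => intro i; simp only [hG, Function.iterate_zero, id]; split_ifs <;> norm_num
    | succ k ih =>
      intro i; rw [hsucc, mulVec_apply_eq_sum]
      exact Finset.sum_nonneg fun j _ => mul_nonneg (hR0 i j) (ih j)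
  have hGS : ∀ k i, 0 < u i → G k i = 0 := fun k => by
    induction k with
    | zero => intro i hi; simp [hG, hi.ne']
    | succ k ih =>
      intro i hi; rw [hsucc, mulVec_apply_eq_sum]
      refine Finset.sum_eq_zero fun j _ => ?_
      rcases (hu.nonneg j).eq_or_lt with h | h
      · rw [(mul_eq_zero.1 (hu.mul_apply_eq_zero hR0 h.symm i)).resolve_left hi.ne', zero_mul]
      · rw [ih j h, mul_zero]
  have hanti : ∀ k i, G (k + 1) i ≤ G k i := fun k => by
    induction k with
    | zero =>
      intro i
      rcases (hu.nonneg i).eq_or_lt with h | h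
      · rw [hsucc, mulVec_apply_eq_sum]
        have : G 0 i = 1 := by simp [hG, ← h]
        rw [this, ← hR i]
        refine Finset.sum_le_sum fun j _ => mul_le_of_le_one_right (hR0 i j) ?_
        simp only [hG, Function.iterate_zero, id]; split_ifs <;> norm_num
      · rw [hGS _ _ h, hGS _ _ h]
    | succ k ih =>
      intro i; rw [hsucc (k + 1)]
      conv_rhs => rw [hsucc k]
      exact hmv _ _ ih i
  have hant : ∀ i, Antitone fun k => G k i := fun i => antitone_nat_of_succ_le fun k => hanti k i
  have hG1 : ∀ k i, G k i ≤ 1 := fun k i => by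
    refine (hant i (Nat.zero_le k)).trans ?_
    simp only [hG, Function.iterate_zero, id]; split_ifs <;> norm_num
  have hlt : ∀ i, ∃ k, G k i < 1 := fun i => by
    have h := hr i
    induction h with
    | refl => exact ⟨0, by rw [hGS _ _ (hu.pos_root hR0 hn hr)]; exact one_pos⟩
    | @tail b i _ hbc ih =>
      obtain ⟨k, hk⟩ := ih
      refine ⟨k + 1, ?_⟩
      rw [hsucc, mulVec_apply_eq_sum, ← hR i]
      refine Finset.sum_lt_sum (fun j _ => mul_le_of_le_one_right (hR0 i j) (hG1 k j))
        ⟨b, Finset.mem_univ b, ?_⟩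
      exact mul_lt_of_lt_one_right hbc hk
  choose k hk using hlt
  -- One time that serves all nodes; the added 1 puts G 0 into the sum below, which makes the weight
  -- positive off the support.
  set m := (∑ i, k i) + 1 with hm
  have hGm : ∀ i, G m i < 1 := fun i => by
    refine lt_of_le_of_lt (hant i ?_) (hk i)
    exact (Finset.single_le_sum (f := k) (fun _ _ => Nat.zero_le _) (Finset.mem_univ i)).trans
      (Nat.le_succ _)
  have hzero : ∀ i, u i = 0 → G 0 i = 1 := fun i hi => by simp [hG, hi]
  refine ⟨fun i => ∑ l ∈ Finset.range m, G l i,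
    fun i hi => Finset.sum_eq_zero fun l _ => hGS l i hi, fun i hi => ?_, fun i hi => ?_⟩
  · refine Finset.sum_pos' (fun l _ => hG0 l i) ⟨0, by simp [hm], ?_⟩
    rw [hzero i hi]; exact one_pos
  -- The sum telescopes: R h − h = G m − G 0, and G 0 = 1 > G m off the support.
  · have e : (R *ᵥ fun i => ∑ l ∈ Finset.range m, G l i) i = ∑ l ∈ Finset.range m, G (l + 1) i := by
      simp_rw [hsucc, mulVec, dotProduct, Finset.mul_sum]
      exact Finset.sum_comm
    rw [e]
    have h1 := Finset.sum_range_succ (fun l => G l i) m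
    have h2 := Finset.sum_range_succ' (fun l => G l i) m
    have h3 := hGm i
    rw [hzero i hi] at h2
    linarith

end Perron

/-- The seminorm `w ↦ ‖(d i * w i)ᵢ‖₂`. -/
noncomputable def weightedEuclidean {n : ℕ} (d : Fin n → ℝ) : Seminorm ℝ (Fin n → ℝ) :=
  (euclideanSeminorm n).comp (Matrix.toLin' (diagonal d))

/-- The seminorm `w ↦ maxᵢ |d i * w i|`. -/
noncomputable def weightedSup {n : ℕ} (d : Fin n → ℝ) : Seminorm ℝ (Fin n → ℝ) :=
  (normSeminorm ℝ (Fin n → ℝ)).comp (Matrix.toLin' (diagonal d))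

lemma weightedEuclidean_apply {n : ℕ} (d w : Fin n → ℝ) :
    weightedEuclidean d w = norm2 fun i => d i * w i := by
  simp only [weightedEuclidean, Seminorm.comp_apply, toLin'_apply, euclideanSeminorm_apply]
  congr 1; ext i; simp [mulVec_diagonal]

lemma weightedSup_apply {n : ℕ} (d w : Fin n → ℝ) :
    weightedSup d w = ‖fun i => d i * w i‖ := by
  simp only [weightedSup, Seminorm.comp_apply, toLin'_apply, coe_normSeminorm]
  congr 1; ext i; simp [mulVec_diagonal]

lemma isMonotone_weightedEuclidean {n : ℕ} (d : Fin n → ℝ) : IsMonotone (weightedEuclidean d) :=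
  fun w z h => by
    simp only [weightedEuclidean_apply]
    refine norm2_le_of_abs_le fun i => ?_
    rw [abs_mul, abs_mul]
    exact mul_le_mul_of_nonneg_left (h i) (abs_nonneg _)

lemma isMonotone_weightedSup {n : ℕ} (d : Fin n → ℝ) : IsMonotone (weightedSup d) :=
  fun w z h => by
    simp only [weightedSup_apply]
    refine (pi_norm_le_iff_of_nonneg (norm_nonneg _)).2 fun i => ?_
    refine le_trans ?_ (norm_le_pi_norm (fun i => d i * z i) i)
    simp only [Real.norm_eq_abs, abs_mul]
    exact mul_le_mul_of_nonneg_left (h i) (abs_nonneg _)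

/-- A monotone norm that is comparable with the Euclidean norm and contracted by `B` can be
rescaled to a contraction norm. -/
lemma exists_isContractionNorm {n : ℕ} {B : Matrix (Fin n) (Fin n) ℝ}
    {N : Seminorm ℝ (Fin n → ℝ)} (hmono : IsMonotone N) {κ : ℝ} (hκ : 0 < κ)
    (hN : ∀ w, norm2 w ≤ κ * N w) {ρ : ℝ} (h0 : 0 ≤ ρ) (h1 : ρ < 1)
    (hB : ∀ w, N (B *ᵥ w) ≤ ρ * N w) :
    ∃ N' : Seminorm ℝ (Fin n → ℝ), IsMonotone N' ∧ IsContractionNorm B N' := by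
  have happ : ∀ w, (κ.toNNReal • N) w = κ * N w := fun w => by
    rw [_root_.smul_apply, NNReal.smul_def, Real.coe_toNNReal _ hκ.le, smul_eq_mul]
  have hm : IsMonotone (κ.toNNReal • N) := fun w z h => by
    rw [happ, happ]
    exact mul_le_mul_of_nonneg_left (hmono w z h) hκ.le
  have hN' : ∀ w, norm2 w ≤ (κ.toNNReal • N) w := fun w => (hN w).trans_eq (happ w).symm
  refine ⟨κ.toNNReal • N, hm, hN', matNorm_diagonal_eq hN' hm, ?_⟩
  refine (matNorm_le h0 fun w => ?_).trans_lt h1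
  rw [happ, happ, mul_left_comm]
  exact mul_le_mul_of_nonneg_left (hB w) hκ.le

/-- The seminorm p sees the support of u and is contracted by itself; q sees the complement and is
contracted up to a multiple of p. A large weight on p absorbs this one-sided coupling. -/
lemma IsLeftPerron.exists_contractionNorm {n : ℕ} {R : Matrix (Fin n) (Fin n) ℝ} {u : Fin n → ℝ}
    (hR0 : ∀ i j, 0 ≤ R i j) (hR : ∀ i, ∑ j, R i j = 1) (hd : ∀ i, 0 < R i i)
    (hu : IsLeftPerron R u) (hn : 0 < n)
    {r : Fin n} (hr : ∀ i, Relation.ReflTransGen (inducedEdge R) r i) :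
    ∃ N, IsMonotone N ∧ IsContractionNorm (R - projR u) N := by
  obtain ⟨ρ, hρ0, hρ1, hρ⟩ := hu.exists_weighted_contraction hR0 hR hd hn hr
  obtain ⟨h, hS, hT, hlt⟩ := hu.exists_weight hR0 hR hn hr
  set B := R - projR u with hB
  set p := weightedEuclidean fun i => √(u i) with hp
  set q := weightedSup fun i => (h i)⁻¹ with hq
  have hp2 : ∀ x, p x ^ 2 = ∑ i, u i * x i ^ 2 := fun x => by
    rw [hp, weightedEuclidean_apply, norm2_sq]
    exact Finset.sum_congr rfl fun i _ => by rw [mul_pow, Real.sq_sqrt (hu.nonneg i)]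
  have hpB : ∀ x, p (B *ᵥ x) ≤ √ρ * p x := fun x => by
    refine le_of_sq_le_sq ?_ (mul_nonneg (Real.sqrt_nonneg _) (apply_nonneg _ _))
    rw [mul_pow, Real.sq_sqrt hρ0, hp2, hp2]
    exact hρ x
  have hsρ : √ρ < 1 := by rw [Real.sqrt_lt' one_pos]; simpa using hρ1
  have hxp : ∀ x j, 0 < u j → |x j| ≤ (√(u j))⁻¹ * p x := fun x j hj => by
    have := abs_apply_le_norm2 (fun i => √(u i) * x i) j
    rw [← weightedEuclidean_apply, abs_mul, abs_of_nonneg (Real.sqrt_nonneg _)] at this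
    rwa [← div_eq_inv_mul, le_div_iff₀' (Real.sqrt_pos.2 hj)]
  have hxq : ∀ x j, u j = 0 → |x j| ≤ h j * q x := fun x j hj => by
    have := norm_le_pi_norm (fun i => (h i)⁻¹ * x i) j
    rw [← weightedSup_apply, Real.norm_eq_abs, abs_mul, abs_inv, abs_of_pos (hT j hj)] at this
    rwa [inv_mul_le_iff₀ (hT j hj)] at this
  have hh0 : ∀ i, 0 ≤ h i := fun i => by
    rcases (hu.nonneg i).eq_or_lt with hi | hi
    · exact (hT i hi.symm).le
    · rw [hS i hi]
  -- the coupling constant between the two blocks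
  set c : ℝ := ∑ i, (h i)⁻¹ * ∑ j, |B i j| * (√(u j))⁻¹ with hc
  have hc0 : 0 ≤ c := Finset.sum_nonneg fun i _ => mul_nonneg (inv_nonneg.2 (hh0 i))
    (Finset.sum_nonneg fun j _ => mul_nonneg (abs_nonneg _) (inv_nonneg.2 (Real.sqrt_nonneg _)))
  -- The largest of finitely many ratios; the default 0 on the support keeps it in [0, 1) even if
  -- the complement is empty.
  obtain ⟨τ, hτ0, hτ1, hτ⟩ : ∃ τ, 0 ≤ τ ∧ τ < 1 ∧ ∀ i, u i = 0 → (R *ᵥ h) i ≤ τ * h i := by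
    have hRh : ∀ i, 0 ≤ (R *ᵥ h) i := fun i => by
      rw [mulVec_apply_eq_sum]
      exact Finset.sum_nonneg fun j _ => mul_nonneg (hR0 i j) (hh0 j)
    have : Nonempty (Fin n) := ⟨r⟩
    obtain ⟨i₀, hi₀⟩ := Finite.exists_max fun i => if u i = 0 then (R *ᵥ h) i / h i else 0
    refine ⟨if u i₀ = 0 then (R *ᵥ h) i₀ / h i₀ else 0, ?_, ?_, fun i hi => ?_⟩
    · split_ifs with hz
      · exact div_nonneg (hRh _) (hh0 _)
      · exact le_rfl
    · split_ifs with hz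
      · rw [div_lt_one (hT _ hz)]; exact hlt _ hz
      · exact one_pos
    · have := hi₀ i
      rw [if_pos hi, div_le_iff₀ (hT i hi)] at this
      exact this
  have hqB : ∀ x, q (B *ᵥ x) ≤ τ * q x + c * p x := fun x => by
    have hnn : 0 ≤ τ * q x + c * p x :=
      add_nonneg (mul_nonneg hτ0 (apply_nonneg _ _)) (mul_nonneg hc0 (apply_nonneg _ _))
    rw [hq, weightedSup_apply, pi_norm_le_iff_of_nonneg hnn]
    intro i
    rcases (hu.nonneg i).eq_or_lt with hi | hi
    swap
    · rw [hS i hi, _root_.inv_zero, zero_mul, norm_zero]; exact hnn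
    have hi' := hT i hi.symm
    have hterm : ∀ j, |B i j * x j| ≤ R i j * h j * q x + |B i j| * (√(u j))⁻¹ * p x := fun j => by
      rw [abs_mul]
      have a1 : 0 ≤ R i j * h j * q x :=
        mul_nonneg (mul_nonneg (hR0 i j) (hh0 j)) (apply_nonneg _ _)
      have a2 : 0 ≤ |B i j| * (√(u j))⁻¹ * p x :=
        mul_nonneg (mul_nonneg (abs_nonneg _) (inv_nonneg.2 (Real.sqrt_nonneg _)))
          (apply_nonneg _ _)
      rcases (hu.nonneg j).eq_or_lt with hj | hj
      -- Column j of the projection is zero here, so B and R agree.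
      · have hBR : |B i j| = R i j := by
          rw [hB, Matrix.sub_apply, projR, of_apply, ← hj, zero_div, sub_zero,
            abs_of_nonneg (hR0 i j)]
        have := mul_le_mul_of_nonneg_left (hxq x j hj.symm) (abs_nonneg (B i j))
        rw [hBR] at this ⊢
        rw [hBR] at a2
        linarith
      · have := mul_le_mul_of_nonneg_left (hxp x j hj) (abs_nonneg (B i j))
        linarith
    have hsum : |(B *ᵥ x) i| ≤ (R *ᵥ h) i * q x + (∑ j, |B i j| * (√(u j))⁻¹) * p x := by
      rw [mulVec_apply_eq_sum, mulVec_apply_eq_sum, Finset.sum_mul, Finset.sum_mul,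
        ← Finset.sum_add_distrib]
      exact (Finset.abs_sum_le_sum_abs _ _).trans (Finset.sum_le_sum fun j _ => hterm j)
    rw [Real.norm_eq_abs, abs_mul, abs_of_pos (inv_pos.2 hi')]
    calc (h i)⁻¹ * |(B *ᵥ x) i|
        ≤ (h i)⁻¹ * (τ * h i * q x + (∑ j, |B i j| * (√(u j))⁻¹) * p x) := by
          refine mul_le_mul_of_nonneg_left (hsum.trans ?_) (inv_pos.2 hi').le
          have := mul_le_mul_of_nonneg_right (hτ i hi.symm) (apply_nonneg q x)
          linarith
      _ = τ * q x + ((h i)⁻¹ * ∑ j, |B i j| * (√(u j))⁻¹) * p x := by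
          field_simp
      _ ≤ τ * q x + c * p x := by
          gcongr
          exact Finset.single_le_sum
            (f := fun i => (h i)⁻¹ * ∑ j, |B i j| * (√(u j))⁻¹)
            (fun i _ => mul_nonneg (inv_nonneg.2 (hh0 i)) (Finset.sum_nonneg fun j _ =>
              mul_nonneg (abs_nonneg _) (inv_nonneg.2 (Real.sqrt_nonneg _)))) (Finset.mem_univ i)
  -- the combined norm `K p + q`
  set K : ℝ := 2 * c / (1 - √ρ) + 1 with hK
  have hK1 : 1 ≤ K := by
    have : 0 ≤ 2 * c / (1 - √ρ) := div_nonneg (by positivity) (by linarith)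
    linarith
  -- The coupling may use up half of the gap 1 − √ρ, which leaves the rate (1 + √ρ)/2 for the p
  -- part.
  have hKc : c ≤ K * ((1 - √ρ) / 2) := by
    have : 2 * c / (1 - √ρ) * ((1 - √ρ) / 2) = c := by
      field_simp [(sub_pos.2 hsρ).ne']
    rw [hK, add_mul, this]; linarith
  set N : Seminorm ℝ (Fin n → ℝ) := K.toNNReal • p + q with hN
  have happ : ∀ w, N w = K * p w + q w := fun w => by
    rw [hN, _root_.add_apply, _root_.smul_apply, NNReal.smul_def,
      Real.coe_toNNReal _ (by linarith), smul_eq_mul]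
  -- At each j one of the two summands is zero: h vanishes on the support, and the inverse of 0 is 0
  -- off it.
  set κ : ℝ := ∑ j, ((√(u j))⁻¹ + h j) + 1 with hκ
  have hκ0 : ∀ j, 0 ≤ (√(u j))⁻¹ + h j := fun j =>
    add_nonneg (inv_nonneg.2 (Real.sqrt_nonneg _)) (hh0 j)
  have hκpos : 0 < κ := add_pos_of_nonneg_of_pos (Finset.sum_nonneg fun j _ => hκ0 j) one_pos
  refine exists_isContractionNorm (N := N) (κ := κ) (ρ := max ((1 + √ρ) / 2) τ) ?_ hκpos
    ?_ (le_max_of_le_right hτ0) (max_lt (by linarith) hτ1) fun w => ?_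
  · intro w z hwz
    rw [happ, happ]
    exact add_le_add (mul_le_mul_of_nonneg_left (isMonotone_weightedEuclidean _ w z hwz)
      (by linarith)) (isMonotone_weightedSup _ w z hwz)
  · intro w
    have hNnn : 0 ≤ N w := apply_nonneg _ _
    have hpN : p w ≤ N w := by
      rw [happ]; nlinarith [apply_nonneg p w, apply_nonneg q w]
    have hqN : q w ≤ N w := by
      rw [happ]; nlinarith [apply_nonneg p w, apply_nonneg q w]
    have hw : ∀ j, |w j| ≤ ((√(u j))⁻¹ + h j) * N w := fun j => by
      have b1 : 0 ≤ (√(u j))⁻¹ := inv_nonneg.2 (Real.sqrt_nonneg _)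
      rcases (hu.nonneg j).eq_or_lt with hj | hj
      · have := hxq w j hj.symm
        nlinarith [mul_le_mul_of_nonneg_left hqN (hh0 j), mul_nonneg b1 hNnn]
      · have := hxp w j hj
        nlinarith [mul_le_mul_of_nonneg_left hpN b1, mul_nonneg (hh0 j) hNnn]
    have hl1 : norm2 w ≤ ∑ j, |w j| := by
      refine le_of_sq_le_sq ?_ (Finset.sum_nonneg fun _ _ => abs_nonneg _)
      rw [norm2_sq]
      calc ∑ i, w i ^ 2 = ∑ i, |w i| ^ 2 := by simp
        _ ≤ (∑ i, |w i|) ^ 2 := Finset.sum_sq_le_sq_sum_of_nonneg fun _ _ => abs_nonneg _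
    refine hl1.trans ((Finset.sum_le_sum fun j _ => hw j).trans ?_)
    rw [← Finset.sum_mul, hκ, add_mul]
    linarith
  · have hp0 : 0 ≤ p w := apply_nonneg _ _
    have hq0 : 0 ≤ q w := apply_nonneg _ _
    rw [happ, happ]
    calc K * p (B *ᵥ w) + q (B *ᵥ w) ≤ K * (√ρ * p w) + (τ * q w + K * ((1 - √ρ) / 2) * p w) := by
          gcongr
          · exact hpB w
          · exact (hqB w).trans (by gcongr)
      _ = (1 + √ρ) / 2 * (K * p w) + τ * q w := by ring
      _ ≤ max ((1 + √ρ) / 2) τ * (K * p w) + max ((1 + √ρ) / 2) τ * q w := by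
          gcongr
          · exact le_max_left _ _
          · exact le_max_right _ _
      _ = _ := by ring

/-! ### Dual norms -/

section Dual

variable {n : ℕ} {N : Seminorm ℝ (Fin n → ℝ)}

lemma dual_bddAbove (hN : ∀ w, norm2 w ≤ N w) (y : Fin n → ℝ) :
    BddAbove ((fun x => y ⬝ᵥ x) '' {x | N x ≤ 1}) := by
  refine ⟨norm2 y, ?_⟩
  rintro _ ⟨x, hx, rfl⟩
  refine (dotProduct_le_norm2 y x).trans ?_
  exact mul_le_of_le_one_right (norm2_nonneg y) ((hN x).trans hx)

lemma dual_nonempty (N : Seminorm ℝ (Fin n → ℝ)) (y : Fin n → ℝ) :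
    ((fun x => y ⬝ᵥ x) '' {x | N x ≤ 1}).Nonempty := ⟨_, 0, by simp, rfl⟩

lemma le_dual (hN : ∀ w, norm2 w ≤ N w) (y : Fin n → ℝ) {x : Fin n → ℝ} (hx : N x ≤ 1) :
    y ⬝ᵥ x ≤ sSup ((fun x => y ⬝ᵥ x) '' {x | N x ≤ 1}) :=
  le_csSup (dual_bddAbove hN y) ⟨x, hx, rfl⟩

/-- The dual norm of a norm. -/
noncomputable def dualSeminorm (N : Seminorm ℝ (Fin n → ℝ)) (hN : ∀ w, norm2 w ≤ N w) :
    Seminorm ℝ (Fin n → ℝ) :=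
  Seminorm.ofSMulLE (fun y => sSup ((fun x => y ⬝ᵥ x) '' {x | N x ≤ 1}))
    (by
      have h : {x | N x ≤ 1}.Nonempty := ⟨0, by simp⟩
      simp [h.image_const])
    (fun y z => csSup_le (dual_nonempty N _) <| by
      rintro _ ⟨x, hx, rfl⟩
      simp only [add_dotProduct]
      exact add_le_add (le_dual hN y hx) (le_dual hN z hx))
    (fun r y => csSup_le (dual_nonempty N _) <| by
      rintro _ ⟨x, hx, rfl⟩
      simp only [smul_dotProduct, smul_eq_mul, Real.norm_eq_abs]
      rcases abs_cases r with ⟨h, -⟩ | ⟨h, h'⟩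
      · rw [h]; exact mul_le_mul_of_nonneg_left (le_dual hN y hx) (h ▸ abs_nonneg r)
      · rw [h, ← neg_mul_neg, ← dotProduct_neg]
        refine mul_le_mul_of_nonneg_left (le_dual hN y ?_) (by linarith)
        rwa [map_neg_eq_map])

lemma dualSeminorm_apply (hN : ∀ w, norm2 w ≤ N w) (y : Fin n → ℝ) :
    dualSeminorm N hN y = sSup ((fun x => y ⬝ᵥ x) '' {x | N x ≤ 1}) := rfl

lemma dualSeminorm_le (hN : ∀ w, norm2 w ≤ N w) {y : Fin n → ℝ} {c : ℝ}
    (h : ∀ x, N x ≤ 1 → y ⬝ᵥ x ≤ c) : dualSeminorm N hN y ≤ c :=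
  csSup_le (dual_nonempty N y) <| by rintro _ ⟨x, hx, rfl⟩; exact h x hx

lemma dotProduct_le_dualSeminorm (hN : ∀ w, norm2 w ≤ N w) (y x : Fin n → ℝ) :
    y ⬝ᵥ x ≤ dualSeminorm N hN y * N x := by
  rcases (apply_nonneg N x).eq_or_lt with h | h
  · have : x = 0 := norm2_eq_zero.1 (le_antisymm (h ▸ hN x) (norm2_nonneg x))
    simp [this]
  · have h1 : N ((N x)⁻¹ • x) ≤ 1 := by
      rw [map_smul_eq_mul, Real.norm_eq_abs, abs_of_pos (inv_pos.2 h), inv_mul_cancel₀ h.ne']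
    have := le_dual hN y h1
    rwa [dotProduct_smul, smul_eq_mul, ← dualSeminorm_apply, inv_mul_le_iff₀ h, mul_comm] at this

lemma isMonotone_dualSeminorm (hN : ∀ w, norm2 w ≤ N w) (hmono : IsMonotone N) :
    IsMonotone (dualSeminorm N hN) := fun y z h => by
  refine dualSeminorm_le hN fun x hx => ?_
  -- Giving the entries of x the signs of z does not increase N and turns the pairing with z into Σ
  -- |z i| |x i|.
  set x' : Fin n → ℝ := fun i => if 0 ≤ z i then |x i| else -|x i| with hx'
  have h1 : N x' ≤ 1 := (hmono x' x fun i => by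
    simp only [hx']; split_ifs <;> simp).trans hx
  refine le_trans (Finset.sum_le_sum fun i _ => ?_) (le_dual hN z h1)
  have h2 : z i * x' i = |z i| * |x i| := by
    simp only [hx']
    split_ifs with hz
    · rw [abs_of_nonneg hz]
    · rw [abs_of_neg (not_le.1 hz)]; ring
  rw [h2]
  refine (le_abs_self _).trans ?_
  rw [abs_mul]
  exact mul_le_mul_of_nonneg_right (h i) (abs_nonneg _)

/-- Pairing (Bᵀw)·x = w·(Bx) shows that the dual norm contracts Bᵀ at the same rate. It dominates
the Euclidean norm only up to the factor K, hence the rescaling. -/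
lemma IsContractionNorm.exists_transpose {B : Matrix (Fin n) (Fin n) ℝ} (hmono : IsMonotone N)
    (hB : IsContractionNorm B N) : ∃ N', IsMonotone N' ∧ IsContractionNorm Bᵀ N' := by
  obtain ⟨K, hK, hKN⟩ := exists_seminorm_le N
  have hN := hB.norm2_le
  refine exists_isContractionNorm (N := dualSeminorm N hN) (isMonotone_dualSeminorm hN hmono) hK
    (fun w => ?_) (matNorm_nonneg N B) hB.contraction fun w => dualSeminorm_le hN fun x hx => ?_
  · rcases (norm2_nonneg w).eq_or_lt with h | h
    · rw [← h]; exact mul_nonneg hK.le (apply_nonneg _ _)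
    · have h1 : norm2 w ^ 2 ≤ dualSeminorm N hN w * (K * norm2 w) := by
        have : norm2 w ^ 2 = w ⬝ᵥ w := by
          rw [norm2_sq]; exact Finset.sum_congr rfl fun i _ => pow_two _
        rw [this]
        exact (dotProduct_le_dualSeminorm hN w w).trans
          (mul_le_mul_of_nonneg_left (hKN w) (apply_nonneg _ _))
      nlinarith
  · rw [mulVec_transpose, ← dotProduct_mulVec]
    refine (dotProduct_le_dualSeminorm hN w _).trans ?_
    rw [mul_comm]
    refine mul_le_mul_of_nonneg_right ?_ (apply_nonneg _ _)
    exact (apply_mulVec_le hN B x).trans (mul_le_of_le_one_right (matNorm_nonneg _ _) hx)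

end Dual

lemma StochasticPair.exists_contractionNorm_row {n : ℕ} {R C : Matrix (Fin n) (Fin n) ℝ}
    (hRC : StochasticPair R C) (hn : 0 < n) (hroot : (roots R).Nonempty) {u : Fin n → ℝ}
    (hu : IsLeftPerron R u) : ∃ N, IsContractionNorm (R - projR u) N := by
  obtain ⟨r, T, hT⟩ := hroot
  obtain ⟨N, -, hN⟩ := hu.exists_contractionNorm (fun i j => hRC.row.1 i j)
    (sum_row_of_mem_rowStochastic hRC.row) hRC.diag_row hn (r := r)
    fun i => (hT.reach i).lift id hT.subgraph
  exact ⟨N, hN⟩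

/-- Cᵀ is row-stochastic with left Perron vector v, so the row case applies to it and duality brings
the norm back to C. -/
lemma StochasticPair.exists_contractionNorm_col {n : ℕ} {R C : Matrix (Fin n) (Fin n) ℝ}
    (hRC : StochasticPair R C) (hn : 0 < n) (hroot : (roots Cᵀ).Nonempty) {v : Fin n → ℝ}
    (hv : IsRightPerron C v) : ∃ N, IsContractionNorm (C - projC v) N := by
  obtain ⟨r, T, hT⟩ := hroot
  have hC := transpose_mem_rowStochastic_iff_mem_colStochastic.2 hRC.col
  have hv' : IsLeftPerron Cᵀ v := ⟨hv.nonneg, by rw [vecMul_transpose, hv.eigen], hv.sum_eq⟩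
  obtain ⟨N, hm, hN⟩ := hv'.exists_contractionNorm (fun i j => hC.1 i j)
    (sum_row_of_mem_rowStochastic hC) hRC.diag_col hn (r := r)
    fun i => (hT.reach i).lift id hT.subgraph
  obtain ⟨N', -, hN'⟩ := hN.exists_transpose hm
  have h : (Cᵀ - projR v)ᵀ = C - projC v := by
    rw [transpose_sub, transpose_transpose]; rfl
  exact ⟨N', h ▸ hN'⟩

/-! ### Strongly convex functions with Lipschitz gradient -/

section Convex

variable {p : ℕ} {μ L : ℝ} {g : EuclideanSpace ℝ (Fin p) → ℝ}

open scoped RealInnerProductSpace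

/-- With c = L‖d‖²/2 or c = μ‖d‖²/2 this derivative has a sign on [0, 1], which yields the two
quadratic bounds below. -/
lemma StronglyConvexSmooth.hasDerivAt_line (hg : StronglyConvexSmooth μ L g)
    (x d : EuclideanSpace ℝ (Fin p)) (c t : ℝ) :
    HasDerivAt (fun t : ℝ => g (x + t • d) - t * ⟪gradient g x, d⟫ - c * t ^ 2)
      (⟪gradient g (x + t • d) - gradient g x, d⟫ - 2 * c * t) t := by
  have hl : HasDerivAt (fun t : ℝ => x + t • d) d t := by
    simpa using ((hasDerivAt_id t).smul_const d).const_add x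
  have h1 : HasDerivAt (fun t : ℝ => g (x + t • d)) ⟪gradient g (x + t • d), d⟫ t := by
    have h : HasDerivAt (fun t : ℝ => g (x + t • d))
        (InnerProductSpace.toDual ℝ _ (gradient g (x + t • d)) d) t :=
      ((hg.differentiable (x + t • d)).hasGradientAt).hasFDerivAt.comp_hasDerivAt t hl
    rwa [InnerProductSpace.toDual_apply_apply] at h
  have h2 := (h1.sub ((hasDerivAt_id t).mul_const ⟪gradient g x, d⟫)).sub
    ((hasDerivAt_pow 2 t).const_mul c)
  refine h2.congr_deriv ?_
  rw [inner_sub_left]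
  simp
  ring

lemma StronglyConvexSmooth.le_quadratic (hg : StronglyConvexSmooth μ L g)
    (x d : EuclideanSpace ℝ (Fin p)) :
    g (x + d) ≤ g x + ⟪gradient g x, d⟫ + L / 2 * ‖d‖ ^ 2 := by
  have hd := hg.hasDerivAt_line x d (L / 2 * ‖d‖ ^ 2)
  have hanti := antitoneOn_of_deriv_nonpos (convex_Icc (0 : ℝ) 1)
    (fun t _ => (hd t).continuousAt.continuousWithinAt)
    (fun t _ => (hd t).differentiableAt.differentiableWithinAt) (fun t ht => by
      rw [interior_Icc] at ht
      rw [(hd t).deriv]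
      have h1 := real_inner_le_norm (gradient g (x + t • d) - gradient g x) d
      have h2 := hg.lipschitz (x + t • d) x
      rw [add_sub_cancel_left, norm_smul, Real.norm_eq_abs, abs_of_pos ht.1] at h2
      have h3 := mul_le_mul_of_nonneg_right h2 (norm_nonneg d)
      linarith)
  have h := hanti (Set.left_mem_Icc.2 zero_le_one) (Set.right_mem_Icc.2 zero_le_one) zero_le_one
  simp only [zero_smul, one_smul, add_zero] at h
  linarith

lemma StronglyConvexSmooth.quadratic_le (hg : StronglyConvexSmooth μ L g)
    (x d : EuclideanSpace ℝ (Fin p)) :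
    g x + ⟪gradient g x, d⟫ + μ / 2 * ‖d‖ ^ 2 ≤ g (x + d) := by
  have hd := hg.hasDerivAt_line x d (μ / 2 * ‖d‖ ^ 2)
  have hmono := monotoneOn_of_deriv_nonneg (convex_Icc (0 : ℝ) 1)
    (fun t _ => (hd t).continuousAt.continuousWithinAt)
    (fun t _ => (hd t).differentiableAt.differentiableWithinAt) (fun t ht => by
      rw [interior_Icc] at ht
      rw [(hd t).deriv]
      have h2 := hg.strong (x + t • d) x
      rw [add_sub_cancel_left, norm_smul, Real.norm_eq_abs, abs_of_pos ht.1,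
        real_inner_smul_right] at h2
      have h3 : t * (μ * t * ‖d‖ ^ 2) ≤ t * ⟪gradient g (x + t • d) - gradient g x, d⟫ := by
        linarith
      have := le_of_mul_le_mul_left h3 ht.1
      linarith)
  have h := hmono (Set.left_mem_Icc.2 zero_le_one) (Set.right_mem_Icc.2 zero_le_one) zero_le_one
  simp only [zero_smul, one_smul, add_zero] at h
  linarith

/-- This is cocoercivity of the gradient of g − μ‖·‖²/2, which is convex and (L − μ)-smooth; D is
its gradient difference. -/
lemma StronglyConvexSmooth.cocoercive (hg : StronglyConvexSmooth μ L g) (hμL : μ ≤ L)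
    (x y : EuclideanSpace ℝ (Fin p)) :
    ‖gradient g x - gradient g y - μ • (x - y)‖ ^ 2 ≤
      (L - μ) * ⟪gradient g x - gradient g y - μ • (x - y), x - y⟫ := by
  set D := gradient g x - gradient g y - μ • (x - y) with hD
  -- The points y + sD and x − sD are each estimated from below at one base point and from above at
  -- the other. The free parameter s is later set to 1/(L − μ), or made large enough to force D = 0
  -- if L = μ.
  have key : ∀ s : ℝ, 2 * s * ‖D‖ ^ 2 - (L - μ) * s ^ 2 * ‖D‖ ^ 2 ≤ ⟪D, x - y⟫ := fun s => by
    have a1 := hg.quadratic_le x (s • D - (x - y))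
    have a2 := hg.le_quadratic y (s • D)
    have a3 := hg.quadratic_le y ((x - y) - s • D)
    have a4 := hg.le_quadratic x (-(s • D))
    have e1 : x + (s • D - (x - y)) = y + s • D := by abel
    have e2 : y + ((x - y) - s • D) = x + -(s • D) := by abel
    rw [e1] at a1
    rw [e2] at a3
    rw [norm_sub_rev] at a3
    have n1 : ‖s • D - (x - y)‖ ^ 2 = s ^ 2 * ‖D‖ ^ 2 - 2 * (s * ⟪D, x - y⟫) + ‖x - y‖ ^ 2 := by
      rw [norm_sub_sq_real, norm_smul, mul_pow, Real.norm_eq_abs, sq_abs, real_inner_smul_left]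
    have n2 : ‖s • D‖ ^ 2 = s ^ 2 * ‖D‖ ^ 2 := by
      rw [norm_smul, mul_pow, Real.norm_eq_abs, sq_abs]
    rw [n1] at a1 a3
    rw [norm_neg, n2] at a4
    rw [n2] at a2
    simp only [inner_sub_right, inner_neg_right, real_inner_smul_right] at a1 a2 a3 a4
    have i1 : ‖D‖ ^ 2 = ⟪gradient g x, D⟫ - ⟪gradient g y, D⟫ - μ * ⟪D, x - y⟫ := by
      rw [← real_inner_self_eq_norm_sq]
      conv_lhs => rw [hD, inner_sub_left, inner_sub_left, real_inner_smul_left]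
      rw [← hD, real_inner_comm D (x - y)]
    have i2 : ⟪D, x - y⟫ = ⟪gradient g x, x⟫ - ⟪gradient g x, y⟫ -
        (⟪gradient g y, x⟫ - ⟪gradient g y, y⟫) - μ * ‖x - y‖ ^ 2 := by
      conv_lhs => rw [hD, inner_sub_left, inner_sub_left, real_inner_smul_left,
        real_inner_self_eq_norm_sq, inner_sub_right, inner_sub_right]
    have i3 : s * ‖D‖ ^ 2 =
        s * (⟪gradient g x, D⟫ - ⟪gradient g y, D⟫ - μ * ⟪D, x - y⟫) := by rw [← i1]
    rw [← inner_sub_right D x y] at a1 a3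
    linarith
  rcases hμL.eq_or_lt with h | h
  · have hz : ‖D‖ ^ 2 = 0 := by
      by_contra hne
      have := key ((⟪D, x - y⟫ + 1) / (2 * ‖D‖ ^ 2))
      have e : 2 * ((⟪D, x - y⟫ + 1) / (2 * ‖D‖ ^ 2)) * ‖D‖ ^ 2 = ⟪D, x - y⟫ + 1 := by
        rw [mul_comm 2, mul_assoc, div_mul_cancel₀ _ (mul_ne_zero two_ne_zero hne)]
      rw [← h, sub_self, zero_mul, zero_mul, e] at this
      linarith
    rw [hz, ← h, sub_self, zero_mul]
  · have hp : 0 < L - μ := sub_pos.2 h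
    have := key (L - μ)⁻¹
    have e : 2 * (L - μ)⁻¹ * ‖D‖ ^ 2 - (L - μ) * (L - μ)⁻¹ ^ 2 * ‖D‖ ^ 2
        = (L - μ)⁻¹ * ‖D‖ ^ 2 := by field_simp; ring
    rw [e, inv_mul_le_iff₀ hp] at this
    exact this

/-- Splitting off μ(x − y) from the gradient gives (1 − bμ)(x − y) − bD. After squaring,
cocoercivity bounds the terms in D by −b(2 − b(μ + L))⟨D, x − y⟩ ≤ 0. -/
lemma StronglyConvexSmooth.gradient_step (hg : StronglyConvexSmooth μ L g) (hμL : μ ≤ L)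
    {b : ℝ} (hb : 0 ≤ b) (hbμ : b * μ ≤ 1) (hbL : b * (μ + L) ≤ 2)
    {y : EuclideanSpace ℝ (Fin p)} (hy : gradient g y = 0) (x : EuclideanSpace ℝ (Fin p)) :
    ‖x - b • gradient g x - y‖ ≤ (1 - b * μ) * ‖x - y‖ := by
  refine le_of_sq_le_sq ?_ (mul_nonneg (by linarith) (norm_nonneg _))
  have hc := hg.cocoercive hμL x y
  have hs := hg.strong x y
  rw [hy, sub_zero] at hc hs
  set D := gradient g x - μ • (x - y) with hD
  have e : x - b • gradient g x - y = (1 - b * μ) • (x - y) - b • D := by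
    rw [hD]; module
  have hin : 0 ≤ ⟪D, x - y⟫ := by
    rw [hD, inner_sub_left, real_inner_smul_left, real_inner_self_eq_norm_sq]; linarith
  rw [e, norm_sub_sq_real, norm_smul, norm_smul, mul_pow, mul_pow, Real.norm_eq_abs,
    Real.norm_eq_abs, sq_abs, sq_abs, real_inner_smul_left, real_inner_smul_right,
    real_inner_comm, mul_pow]
  have h1 := mul_le_mul_of_nonneg_left hc (sq_nonneg b)
  have h2 : 0 ≤ b * (2 - b * (μ + L)) * ⟪D, x - y⟫ :=
    mul_nonneg (mul_nonneg hb (by linarith)) hin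
  nlinarith

lemma gradient_average {n : ℕ} {f : Fin n → EuclideanSpace ℝ (Fin p) → ℝ}
    (hf : ∀ i, Differentiable ℝ (f i)) (x : EuclideanSpace ℝ (Fin p)) :
    HasGradientAt (fun z => (n : ℝ)⁻¹ * ∑ i, f i z) ((n : ℝ)⁻¹ • ∑ i, gradient (f i) x) x := by
  rw [hasGradientAt_iff_hasFDerivAt]
  have h : HasFDerivAt (fun z => ∑ i, f i z)
      (∑ i, (InnerProductSpace.toDual ℝ _) (gradient (f i) x)) x :=
    HasFDerivAt.fun_sum fun i _ => ((hf i x).hasGradientAt).hasFDerivAt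
  have h2 := h.const_mul (n : ℝ)⁻¹
  simpa using h2

lemma StronglyConvexSmooth.average {n : ℕ} (hn : 0 < n)
    {f : Fin n → EuclideanSpace ℝ (Fin p) → ℝ} (hf : ∀ i, StronglyConvexSmooth μ L (f i)) :
    StronglyConvexSmooth μ L fun z => (n : ℝ)⁻¹ * ∑ i, f i z := by
  have hn' : (0 : ℝ) < n := by exact_mod_cast hn
  have hgr := fun x => (gradient_average (fun i => (hf i).differentiable) x)
  have hgrad : ∀ x x' : EuclideanSpace ℝ (Fin p), (n : ℝ)⁻¹ • ∑ i, gradient (f i) x -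
      (n : ℝ)⁻¹ • ∑ i, gradient (f i) x' =
      (n : ℝ)⁻¹ • ∑ i, (gradient (f i) x - gradient (f i) x') := fun x x' => by
    rw [Finset.sum_sub_distrib, smul_sub]
  refine ⟨fun x => (hgr x).differentiableAt, fun x x' => ?_, fun x x' => ?_⟩
  · rw [(hgr x).gradient, (hgr x').gradient, hgrad, real_inner_smul_left, sum_inner,
      le_inv_mul_iff₀ hn']
    have h := Finset.sum_le_sum fun i (_ : i ∈ Finset.univ) => (hf i).strong x x'
    simpa using h
  · rw [(hgr x).gradient, (hgr x').gradient, hgrad, norm_smul, norm_inv, Real.norm_eq_abs,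
      abs_of_pos hn', inv_mul_le_iff₀ hn']
    have h := (norm_sum_le Finset.univ fun i => gradient (f i) x - gradient (f i) x').trans
      (Finset.sum_le_sum fun i (_ : i ∈ Finset.univ) => (hf i).lipschitz x x')
    simpa using h

/-- Compare both bounds at two points at distance 1, which exist because p ≥ 1. -/
lemma StronglyConvexSmooth.le_of_pos (hg : StronglyConvexSmooth μ L g) (hp : 1 ≤ p) : μ ≤ L := by
  set x : EuclideanSpace ℝ (Fin p) := EuclideanSpace.single ⟨0, hp⟩ 1 with hx
  have hn : ‖x - 0‖ = 1 := by simp [hx]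
  have h1 := hg.strong x 0
  have h2 := hg.lipschitz x 0
  have h3 := real_inner_le_norm (gradient g x - gradient g 0) (x - 0)
  rw [hn] at h1 h2 h3
  linarith

end Convex

/-! ### Nonnegative matrices -/

lemma mulVec_mono {m : ℕ} {A : Matrix (Fin m) (Fin m) ℝ} (hA : ∀ i j, 0 ≤ A i j)
    {x y : Fin m → ℝ} (h : ∀ i, x i ≤ y i) (i : Fin m) : (A *ᵥ x) i ≤ (A *ᵥ y) i := by
  rw [mulVec_apply_eq_sum, mulVec_apply_eq_sum]
  exact Finset.sum_le_sum fun j _ => mul_le_mul_of_nonneg_left (h j) (hA i j)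

lemma mul_le_mulVec_apply {m : ℕ} {A : Matrix (Fin m) (Fin m) ℝ} (hA : ∀ i j, 0 ≤ A i j)
    {x : Fin m → ℝ} (h : ∀ i, 0 ≤ x i) (i j : Fin m) : A i j * x j ≤ (A *ᵥ x) i := by
  rw [mulVec_apply_eq_sum]
  exact Finset.single_le_sum (f := fun j => A i j * x j)
    (fun j _ => mul_nonneg (hA i j) (h j)) (Finset.mem_univ j)

lemma mulVec_nonneg {m : ℕ} {A : Matrix (Fin m) (Fin m) ℝ} (hA : ∀ i j, 0 ≤ A i j)
    {x : Fin m → ℝ} (h : ∀ i, 0 ≤ x i) (i : Fin m) : 0 ≤ (A *ᵥ x) i :=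
  (mul_nonneg (hA i i) (h i)).trans (mul_le_mulVec_apply hA h i i)

/-- A Perron eigenvector: a nonnegative matrix with a positive row and a positive column of the
same index has a positive eigenvector for a positive eigenvalue. -/
lemma exists_pos_eigenvector {m : ℕ} {A : Matrix (Fin m) (Fin m) ℝ} (hA : ∀ i j, 0 ≤ A i j)
    (p : Fin m) (hcol : ∀ i, 0 < A i p) (hrow : ∀ j, 0 < A p j) :
    ∃ t : ℝ, 0 < t ∧ ∃ w : Fin m → ℝ, (∀ i, 0 < w i) ∧ A *ᵥ w = t • w := by
  set T := ∑ i, ∑ j, A i j with hT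
  have hle : ∀ x ∈ stdSimplex ℝ (Fin m), ∀ t : ℝ, (∀ i, t * x i ≤ (A *ᵥ x) i) → t ≤ T := by
    intro x hx t ht
    have h1 := Finset.sum_le_sum fun i (_ : i ∈ Finset.univ) => ht i
    rw [← Finset.mul_sum, hx.2, mul_one] at h1
    refine h1.trans (Finset.sum_le_sum fun i _ => ?_)
    rw [mulVec_apply_eq_sum]
    refine Finset.sum_le_sum fun j _ => mul_le_of_le_one_right (hA i j) ?_
    rw [← hx.2]
    exact Finset.single_le_sum (fun j _ => hx.1 j) (Finset.mem_univ j)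
  -- Collatz–Wielandt: the largest t with t x ≤ A x for some x in the simplex is an eigenvalue.
  set Z : Set (ℝ × (Fin m → ℝ)) :=
    (Set.Icc 0 T ×ˢ stdSimplex ℝ (Fin m)) ∩ ⋂ i, {z | z.1 * z.2 i ≤ (A *ᵥ z.2) i} with hZ
  have hZc : IsCompact Z := by
    refine (isCompact_Icc.prod (isCompact_stdSimplex ℝ (Fin m))).inter_right
      (isClosed_iInter fun i => isClosed_le (by fun_prop) ?_)
    exact (continuous_apply i).comp (Continuous.matrix_mulVec continuous_const continuous_snd)
  have hZn : Z.Nonempty := by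
    have h0 : Pi.single p 1 ∈ stdSimplex ℝ (Fin m) := single_mem_stdSimplex ℝ p
    refine ⟨(0, Pi.single p 1), ⟨⟨⟨le_rfl, ?_⟩, h0⟩, ?_⟩⟩
    · exact Finset.sum_nonneg fun i _ => Finset.sum_nonneg fun j _ => hA i j
    · simp only [Set.mem_iInter, Set.mem_ofPred_eq, zero_mul]
      exact mulVec_nonneg hA h0.1
  obtain ⟨⟨t, x⟩, ⟨⟨ht, hx⟩, hxt⟩, hmax⟩ := hZc.exists_isMaxOn hZn continuous_fst.continuousOn
  simp only [Set.mem_iInter, Set.mem_ofPred_eq] at hxt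
  have hx0 : ∀ i, 0 ≤ x i := hx.1
  have ht0 : 0 ≤ t := ht.1
  set d : Fin m → ℝ := fun i => (A *ᵥ x) i - t * x i with hd
  have hd0 : ∀ i, 0 ≤ d i := fun i => sub_nonneg.2 (hxt i)
  have hdA : d = A *ᵥ x - t • x := rfl
  have heig : ∀ k, d k = 0 := by
    by_contra! hk
    obtain ⟨k, hk⟩ := hk
    have hk' : 0 < d k := (hd0 k).lt_of_ne hk.symm
    have h1 : 0 < (A *ᵥ d) p := (mul_pos (hrow k) hk').trans_le (mul_le_mulVec_apply hA hd0 p k)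
    -- Row p carries any positive entry of the defect d to index p, and column p spreads it
    -- everywhere. So A²x satisfies the inequality strictly and t could be increased.
    have h2 : ∀ i, 0 < (A *ᵥ (A *ᵥ d)) i := fun i =>
      (mul_pos (hcol i) h1).trans_le (mul_le_mulVec_apply hA (mulVec_nonneg hA hd0) i p)
    set y := A *ᵥ (A *ᵥ x) with hy
    have hy0 : ∀ i, 0 ≤ y i := mulVec_nonneg hA (mulVec_nonneg hA hx0)
    have hyd : A *ᵥ y - t • y = A *ᵥ (A *ᵥ d) := by
      rw [hdA, mulVec_sub, mulVec_sub, mulVec_smul, mulVec_smul]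
    have hgap : ∀ i, t * y i < (A *ᵥ y) i := fun i => by
      have := congr_fun hyd i
      simp only [Pi.sub_apply, Pi.smul_apply, smul_eq_mul] at this
      linarith [h2 i]
    have hs : 0 < ∑ i, y i := by
      refine (Finset.sum_nonneg fun i _ => hy0 i).lt_of_ne fun h => ?_
      have hz : y = 0 := funext fun i =>
        (Finset.sum_eq_zero_iff_of_nonneg fun i _ => hy0 i).1 h.symm i (Finset.mem_univ i)
      have := hgap p
      simp [hz] at this
    set s := ∑ i, y i with hsdef
    set z : Fin m → ℝ := s⁻¹ • y with hz
    have hzS : z ∈ stdSimplex ℝ (Fin m) := by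
      refine ⟨fun i => mul_nonneg (inv_pos.2 hs).le (hy0 i), ?_⟩
      simp only [hz, Pi.smul_apply, smul_eq_mul, ← Finset.mul_sum]
      exact inv_mul_cancel₀ hs.ne'
    have hgz : ∀ i, 0 < (A *ᵥ z) i - t * z i := fun i => by
      have : (A *ᵥ z) i - t * z i = s⁻¹ * ((A *ᵥ y) i - t * y i) := by
        simp only [hz, mulVec_smul, Pi.smul_apply, smul_eq_mul]; ring
      rw [this]
      exact mul_pos (inv_pos.2 hs) (sub_pos.2 (hgap i))
    have : Nonempty (Fin m) := ⟨p⟩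
    obtain ⟨i₀, hi₀⟩ := Finite.exists_min fun i => (A *ᵥ z) i - t * z i
    set ε := (A *ᵥ z) i₀ - t * z i₀ with hε
    have hε0 : 0 < ε := hgz i₀
    have hmem : ∀ i, (t + ε) * z i ≤ (A *ᵥ z) i := fun i => by
      have hz1 : z i ≤ 1 := by
        rw [← hzS.2]
        exact Finset.single_le_sum (fun j _ => hzS.1 j) (Finset.mem_univ i)
      have := hi₀ i
      nlinarith
    have hmz : (t + ε, z) ∈ Z :=
      ⟨⟨⟨by linarith, hle z hzS _ hmem⟩, hzS⟩, by simpa using hmem⟩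
    have : t + ε ≤ t := hmax hmz
    linarith
  have hAx : ∀ i, (A *ᵥ x) i = t * x i := fun i => sub_eq_zero.1 (heig i)
  obtain ⟨k, hk⟩ : ∃ k, 0 < x k := by
    by_contra! h
    have : ∑ i, x i = 0 := Finset.sum_eq_zero fun i _ => le_antisymm (h i) (hx0 i)
    rw [hx.2] at this
    exact one_ne_zero this
  have h1 : 0 < t * x p := by
    rw [← hAx]
    exact (mul_pos (hrow k) hk).trans_le (mul_le_mulVec_apply hA hx0 p k)
  have htp : 0 < t := ht0.lt_of_ne fun h => by rw [← h, zero_mul] at h1; exact h1.false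
  have hxp : 0 < x p := pos_of_mul_pos_right h1 ht0
  refine ⟨t, htp, x, fun i => ?_, funext hAx⟩
  have h2 : 0 < t * x i := by
    rw [← hAx]
    exact (mul_pos (hcol i) hxp).trans_le (mul_le_mulVec_apply hA hx0 i p)
  exact pos_of_mul_pos_right h2 ht0

lemma mem_spectrum_iff_exists {m : ℕ} (A : Matrix (Fin m) (Fin m) ℂ) (c : ℂ) :
    c ∈ spectrum ℂ A ↔ ∃ z, z ≠ 0 ∧ A *ᵥ z = c • z := by
  rw [← Matrix.spectrum_toLin', ← Module.End.hasEigenvalue_iff_mem_spectrum]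
  constructor
  · intro h
    obtain ⟨z, hz⟩ := h.exists_hasEigenvector
    exact ⟨z, hz.2, by simpa using hz.apply_eq_smul⟩
  · rintro ⟨z, hz, h⟩
    exact Module.End.hasEigenvalue_of_hasEigenvector
      (Module.End.hasEigenvector_iff.2 ⟨Module.End.mem_eigenspace_iff.2 (by simpa using h), hz⟩)

/-- For an eigenvector z, evaluate the eigenvalue equation at the index where |z i| / w i is
largest. -/
lemma spectralRadius_le_of_mulVec_le {m : ℕ} {A : Matrix (Fin m) (Fin m) ℝ}
    (hA : ∀ i j, 0 ≤ A i j) {w : Fin m → ℝ} (hw : ∀ i, 0 < w i) {θ : ℝ}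
    (h : ∀ i, (A *ᵥ w) i ≤ θ * w i) :
    spectralRadius ℂ (A.map (algebraMap ℝ ℂ)) ≤ ENNReal.ofReal θ := by
  refine iSup₂_le fun c hc => ?_
  obtain ⟨z, hz, hAz⟩ := (mem_spectrum_iff_exists _ c).1 hc
  rw [← ENNReal.ofReal_coe_nnreal]
  refine ENNReal.ofReal_le_ofReal ?_
  rw [coe_nnnorm]
  obtain ⟨k, hk⟩ : ∃ k, z k ≠ 0 := Function.ne_iff.1 hz
  have : Nonempty (Fin m) := ⟨k⟩
  obtain ⟨i, hi⟩ := Finite.exists_max fun i => ‖z i‖ / w i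
  have hzi : 0 < ‖z i‖ := by
    have h1 : 0 < ‖z k‖ / w k := div_pos (norm_pos_iff.2 hk) (hw k)
    have h2 := h1.trans_le (hi k)
    rwa [div_pos_iff_of_pos_right (hw i)] at h2
  have hzj : ∀ j, ‖z j‖ ≤ ‖z i‖ / w i * w j := fun j => by
    have := hi j
    rwa [div_le_iff₀ (hw j)] at this
  have e : c * z i = ∑ j, (A i j : ℂ) * z j := by
    have := congr_fun hAz i
    simpa [mulVec, dotProduct] using this.symm
  have h1 : ‖c‖ * ‖z i‖ ≤ ‖z i‖ / w i * (A *ᵥ w) i := by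
    rw [← norm_mul, e, mulVec_apply_eq_sum, Finset.mul_sum]
    refine (norm_sum_le _ _).trans (Finset.sum_le_sum fun j _ => ?_)
    rw [norm_mul, Complex.norm_real, Real.norm_eq_abs, abs_of_nonneg (hA i j)]
    have := mul_le_mul_of_nonneg_left (hzj j) (hA i j)
    linarith
  have h2 : ‖z i‖ / w i * (A *ᵥ w) i ≤ θ * ‖z i‖ := by
    have := mul_le_mul_of_nonneg_left (h i) (div_pos hzi (hw i)).le
    have e2 : ‖z i‖ / w i * (θ * w i) = θ * ‖z i‖ := by field_simp [(hw i).ne']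
    linarith
  exact le_of_mul_le_mul_right (h1.trans h2) hzi

/-- The largest ratio (A w) i / w i is below 1. Finiteness is recorded too, since `specRad` is a
`toReal` and would send ⊤ to 0. -/
lemma specRad_lt_one {m : ℕ} [NeZero m] {A : Matrix (Fin m) (Fin m) ℝ}
    (hA : ∀ i j, 0 ≤ A i j) {w : Fin m → ℝ} (hw : ∀ i, 0 < w i)
    (h : ∀ i, (A *ᵥ w) i < w i) :
    specRad A < 1 ∧ spectralRadius ℂ (A.map (algebraMap ℝ ℂ)) ≠ ⊤ := by
  obtain ⟨i₀, hi₀⟩ := Finite.exists_max fun i => (A *ᵥ w) i / w i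
  have hθ : 0 ≤ (A *ᵥ w) i₀ / w i₀ :=
    div_nonneg (mulVec_nonneg hA (fun i => (hw i).le) _) (hw _).le
  have hle := spectralRadius_le_of_mulVec_le hA hw fun i => (div_le_iff₀ (hw i)).1 (hi₀ i)
  have htop := ne_top_of_le_ne_top ENNReal.ofReal_ne_top hle
  refine ⟨?_, htop⟩
  have h1 : specRad A ≤ (A *ᵥ w) i₀ / w i₀ := ENNReal.toReal_le_of_le_ofReal hθ hle
  exact h1.trans_lt ((div_lt_one (hw _)).2 (h _))

lemma le_specRad {m : ℕ} {A : Matrix (Fin m) (Fin m) ℝ}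
    (htop : spectralRadius ℂ (A.map (algebraMap ℝ ℂ)) ≠ ⊤) {t : ℝ} (ht : 0 ≤ t)
    {w : Fin m → ℝ} (hw : w ≠ 0) (h : A *ᵥ w = t • w) : t ≤ specRad A := by
  have hmem : (t : ℂ) ∈ spectrum ℂ (A.map (algebraMap ℝ ℂ)) := by
    refine (mem_spectrum_iff_exists _ _).2 ⟨fun i => (w i : ℂ), fun h0 => hw ?_, ?_⟩
    · ext i
      simpa using congr_fun h0 i
    · ext i
      have := congr_fun h i
      rw [mulVec_apply_eq_sum] at this
      simp only [Pi.smul_apply, smul_eq_mul] at this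
      simp only [mulVec, dotProduct, map_apply, Complex.coe_algebraMap, Pi.smul_apply, smul_eq_mul]
      exact_mod_cast this
  have h1 : (‖(t : ℂ)‖₊ : ENNReal) ≤ spectralRadius ℂ (A.map (algebraMap ℝ ℂ)) :=
    le_iSup₂ (α := ENNReal) (f := fun c (_ : c ∈ spectrum ℂ (A.map (algebraMap ℝ ℂ))) =>
      (‖c‖₊ : ENNReal)) (t : ℂ) hmem
  have h2 := ENNReal.toReal_mono htop h1
  rwa [ENNReal.coe_toReal, coe_nnnorm, Complex.norm_real, Real.norm_eq_abs, abs_of_nonneg ht] at h2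

/-- A multiple of the positive eigenvector w dominates z 0, and nonnegativity of A propagates this
with the exact factor t per step. -/
lemma le_pow_of_recursion {m : ℕ} {A : Matrix (Fin m) (Fin m) ℝ} (hA : ∀ i j, 0 ≤ A i j)
    {w : Fin m → ℝ} (hw : ∀ i, 0 < w i) {t : ℝ} (h : A *ᵥ w = t • w)
    {z : ℕ → Fin m → ℝ} (hz0 : ∀ k i, 0 ≤ z k i) (hz : ∀ k i, z (k + 1) i ≤ (A *ᵥ z k) i) :
    ∃ c, ∀ k i, z k i ≤ c * t ^ k := by
  set b := ∑ i, z 0 i / w i with hb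
  have hb0 : 0 ≤ b := Finset.sum_nonneg fun i _ => div_nonneg (hz0 0 i) (hw i).le
  have key : ∀ k i, z k i ≤ b * t ^ k * w i := fun k => by
    induction k with
    | zero =>
      intro i
      rw [pow_zero, mul_one, ← div_le_iff₀ (hw i)]
      exact Finset.single_le_sum (f := fun i => z 0 i / w i)
        (fun i _ => div_nonneg (hz0 0 i) (hw i).le) (Finset.mem_univ i)
    | succ k ih =>
      intro i
      refine (hz k i).trans ((mulVec_mono hA (y := (b * t ^ k) • w) ih i).trans (le_of_eq ?_))
      rw [mulVec_smul, h]
      simp only [Pi.smul_apply, smul_eq_mul]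
      ring
  refine ⟨b * ∑ i, w i, fun k i => (key k i).trans ?_⟩
  have ht : 0 ≤ t := by
    have h1 := mulVec_nonneg hA (fun i => (hw i).le) i
    rw [h] at h1
    exact nonneg_of_mul_nonneg_left h1 (hw i)
  have hwi := Finset.single_le_sum (f := w) (fun i _ => (hw i).le) (Finset.mem_univ i)
  have := mul_le_mul_of_nonneg_left hwi (mul_nonneg hb0 (pow_nonneg ht k))
  linarith

/-- The bound is asked only from index 1 on, because in the degenerate case the reduced system
starts after one step. -/
lemma isBigO_specRad_pow {m : ℕ} {A : Matrix (Fin m) (Fin m) ℝ} {t c : ℝ} (ht : 0 ≤ t)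
    (hts : t ≤ specRad A) {z : ℕ → ℝ} (hz0 : ∀ k, 0 ≤ z k)
    (hz : ∀ k, z (k + 1) ≤ c * t ^ (k + 1)) :
    z =O[atTop] fun k => specRad A ^ k := by
  refine IsBigO.of_bound |c| ?_
  filter_upwards [eventually_ge_atTop 1] with k hk
  obtain ⟨l, rfl⟩ := Nat.exists_eq_add_of_le' hk
  rw [Real.norm_eq_abs, Real.norm_eq_abs, abs_of_nonneg (hz0 _),
    abs_of_nonneg (pow_nonneg (ht.trans hts) _)]
  refine (hz l).trans ?_
  gcongr
  exact le_abs_self c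

/-- A nonnegative `3 × 3` matrix `A` with diagonal entries below `1` and `det (1 - A) > 0` has a
positive vector that it strictly decreases. -/
lemma exists_pos_mulVec_lt {a11 a12 a13 a21 a22 a23 a31 a32 a33 : ℝ} (h12 : 0 ≤ a12)
    (h13 : 0 ≤ a13) (h21 : 0 ≤ a21) (h23 : 0 ≤ a23) (h31 : 0 ≤ a31) (h32 : 0 ≤ a32)
    (h11 : a11 < 1) (h22 : a22 < 1) (h33 : a33 < 1)
    (hdet : 0 < (1 - a11) * (1 - a22) * (1 - a33) - a12 * a23 * a31 - a13 * a21 * a32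
      - (1 - a22) * a13 * a31 - (1 - a11) * a23 * a32 - (1 - a33) * a12 * a21) :
    ∃ w : Fin 3 → ℝ, (∀ i, 0 < w i) ∧
      ∀ i, (!![a11, a12, a13; a21, a22, a23; a31, a32, a33] *ᵥ w) i < w i := by
  have e1 := sub_pos.2 h11
  have e2 := sub_pos.2 h22
  have e3 := sub_pos.2 h33
  have p1 : 0 ≤ a12 * a23 * a31 := by positivity
  have p2 : 0 ≤ a13 * a21 * a32 := by positivity
  have p3 : 0 ≤ (1 - a22) * a13 * a31 := by positivity
  have p4 : 0 ≤ (1 - a11) * a23 * a32 := by positivity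
  have p5 : 0 ≤ (1 - a33) * a12 * a21 := by positivity
  -- The principal 2 × 2 minors are positive: discard the other nonnegative terms of the determinant
  -- and cancel a diagonal factor.
  have d1 : 0 < (1 - a22) * (1 - a33) - a23 * a32 := by
    refine pos_of_mul_pos_right (a := 1 - a11) ?_ e1.le; linarith
  have d2 : 0 < (1 - a11) * (1 - a33) - a13 * a31 := by
    refine pos_of_mul_pos_right (a := 1 - a22) ?_ e2.le; linarith
  have d3 : 0 < (1 - a11) * (1 - a22) - a12 * a21 := by
    refine pos_of_mul_pos_right (a := 1 - a33) ?_ e3.le; linarith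
  -- The w's are the row sums of the adjugate of 1 − A, so (1 − A) w is the determinant times the
  -- all-ones vector.
  set w1 := ((1 - a22) * (1 - a33) - a23 * a32) + (a12 * (1 - a33) + a13 * a32)
    + (a12 * a23 + a13 * (1 - a22)) with hw1
  set w2 := (a21 * (1 - a33) + a23 * a31) + ((1 - a11) * (1 - a33) - a13 * a31)
    + ((1 - a11) * a23 + a13 * a21) with hw2
  set w3 := (a21 * a32 + (1 - a22) * a31) + ((1 - a11) * a32 + a12 * a31)
    + ((1 - a11) * (1 - a22) - a12 * a21) with hw3
  have q1 : 0 < w1 := by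
    have : 0 ≤ (a12 * (1 - a33) + a13 * a32) + (a12 * a23 + a13 * (1 - a22)) := by positivity
    linarith
  have q2 : 0 < w2 := by
    have : 0 ≤ (a21 * (1 - a33) + a23 * a31) + ((1 - a11) * a23 + a13 * a21) := by positivity
    linarith
  have q3 : 0 < w3 := by
    have : 0 ≤ (a21 * a32 + (1 - a22) * a31) + ((1 - a11) * a32 + a12 * a31) := by positivity
    linarith
  refine ⟨![w1, w2, w3], fun i => ?_, fun i => ?_⟩
  · fin_cases i <;> assumption
  · rw [mulVec_apply_eq_sum, Fin.sum_univ_three]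
    fin_cases i
    · simp
      rw [hw1, hw2, hw3]; linarith
    · simp
      rw [hw1, hw2, hw3]; linarith
    · simp
      rw [hw1, hw2, hw3]; linarith

/-! ### The step size condition -/

/-- The bound is the positive root of c₁r² + c₂r = c₃, in the rationalized form that also covers c₁
= 0. -/
lemma quadratic_le_of_le_root {c₁ c₂ c₃ a : ℝ} (h1 : 0 ≤ c₁) (h2 : 0 < c₂) (h3 : 0 < c₃)
    (ha : 0 ≤ a) :
    (a ≤ 2 * c₃ / (c₂ + √(c₂ ^ 2 + 4 * c₁ * c₃)) → c₁ * a ^ 2 + c₂ * a ≤ c₃) ∧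
    (a < 2 * c₃ / (c₂ + √(c₂ ^ 2 + 4 * c₁ * c₃)) → c₁ * a ^ 2 + c₂ * a < c₃) := by
  set s := √(c₂ ^ 2 + 4 * c₁ * c₃) with hs
  have hs0 : 0 ≤ s := Real.sqrt_nonneg _
  have hs2 : s ^ 2 = c₂ ^ 2 + 4 * c₁ * c₃ := Real.sq_sqrt (by positivity)
  have hden : 0 < c₂ + s := by linarith
  set r := 2 * c₃ / (c₂ + s) with hr
  have hr0 : 0 < r := by positivity
  have hroot : c₁ * r ^ 2 + c₂ * r = c₃ := by
    rw [hr]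
    field_simp
    linear_combination -hs2
  constructor
  · intro h
    have : c₁ * a ^ 2 ≤ c₁ * r ^ 2 := by gcongr
    have : c₂ * a ≤ c₂ * r := by gcongr
    linarith
  · intro h
    have : c₁ * a ^ 2 ≤ c₁ * r ^ 2 := by gcongr
    have : c₂ * a < c₂ * r := by gcongr
    linarith

section StepSize

variable {μ L M a b U V w q σ τ K D r E : ℝ}

/-- Dictionary: a = α̂, b = α', U = ‖u‖₂, V = ‖v‖₂, w = ‖v‖_R, q = 1/√n, σ = σ_R, τ = σ_C, K =
c₀δ_{C,2}, D = δ_{R,C}, r = ‖R‖₂, E = ‖R − I‖₂. Each bound keeps one summand of the quadratic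
condition; the diagonal entries then also use μ ≤ L and, for the third, M ≤ UVq². -/
lemma step_size_diag (hμ : 0 < μ) (hμL : μ ≤ L) (hM : 0 < M) (ha : 0 < a)
    (hU : 0 < U) (hV : 0 < V) (hw : 0 < w) (hq : 0 < q) (hσ0 : 0 ≤ σ) (hσ1 : σ < 1)
    (hτ1 : τ < 1) (hK : 0 < K) (hD : 0 < D) (hr : 0 < r) (hE : 0 ≤ E)
    (hMUV : M ≤ U * V * q ^ 2)
    (hstep : σ * K * r * V * L ^ 2 * q * (M * D * (L + μ) + q ^ 2 * U * w * L) * a ^ 2 +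
      (σ * K * U * w * E * L ^ 2 * q ^ 2 + K * r * V * U * (1 - σ) * L ^ 2 * q ^ 2 / 2 +
        M * σ * K * D * E * μ * L + M / 2 * σ * w * (1 - τ) * L ^ 2 * q) * a
      ≤ M / 4 * (1 - τ) * (1 - σ) * μ) :
    a * σ * w * L ^ 2 * q < (1 - σ) * μ / 2 ∧ σ * (1 + a * w * (L * q)) < 1 - (1 - σ) / 2 ∧
      K * r * V * U * L ^ 2 * q ^ 2 * a ≤ M * (1 - τ) * μ / 2 ∧
      (0 < σ → K * r * V * U * L ^ 2 * q ^ 2 * a < M * (1 - τ) * μ / 2) ∧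
      τ + a * K * r * L ≤ 1 - (1 - τ) / 2 := by
  have hL : 0 < L := hμ.trans_le hμL
  have hs : 0 < 1 - σ := sub_pos.2 hσ1
  have ht : 0 < 1 - τ := sub_pos.2 hτ1
  have n0 : 0 ≤ σ * K * r * V * L ^ 2 * q * (M * D * (L + μ) + q ^ 2 * U * w * L) * a ^ 2 := by
    positivity
  have n1 : 0 ≤ σ * K * U * w * E * L ^ 2 * q ^ 2 * a := by positivity
  have n2 : 0 < K * r * V * U * (1 - σ) * L ^ 2 * q ^ 2 / 2 * a := by positivity
  have n3 : 0 ≤ M * σ * K * D * E * μ * L * a := by positivity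
  have n4 : 0 ≤ M / 2 * σ * w * (1 - τ) * L ^ 2 * q * a := by positivity
  have s4 : (M / 2 * (1 - τ)) * (a * σ * w * L ^ 2 * q)
      < (M / 2 * (1 - τ)) * ((1 - σ) * μ / 2) := by linarith
  have t4 := lt_of_mul_lt_mul_left s4 (by positivity)
  have s2 : ((1 - σ) / 2) * (K * r * V * U * L ^ 2 * q ^ 2 * a)
      ≤ ((1 - σ) / 2) * (M * (1 - τ) * μ / 2) := by linarith
  have t2 := le_of_mul_le_mul_left s2 (by positivity)
  refine ⟨t4, ?_, t2, fun hσ => ?_, ?_⟩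
  · have h1 : L * (a * σ * w * (L * q)) < L * ((1 - σ) / 2) := by
      have : (1 - σ) * μ ≤ (1 - σ) * L := by gcongr
      linarith
    have := lt_of_mul_lt_mul_left h1 hL.le
    linarith
  · have n4' : 0 < M / 2 * σ * w * (1 - τ) * L ^ 2 * q * a := by positivity
    have s2' : ((1 - σ) / 2) * (K * r * V * U * L ^ 2 * q ^ 2 * a)
      < ((1 - σ) / 2) * (M * (1 - τ) * μ / 2) := by linarith
    exact lt_of_mul_lt_mul_left s2' (by positivity)
  · have h1 : (U * V * q ^ 2 * L) * (a * K * r * L) ≤ (U * V * q ^ 2 * L) * ((1 - τ) / 2) := by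
      have e1 : M * (1 - τ) * μ / 2 ≤ (U * V * q ^ 2) * (1 - τ) * L / 2 := by gcongr
      linarith
    have := le_of_mul_le_mul_left h1 (by positivity)
    linarith

/-- The determinant is affine in b with nonnegative slope, so b may be lowered to Ma. What remains
is bilinear in the diagonal gaps e2, e3 and is smallest at the corner (s/2, t/2), where it equals
a(c₃ − c₂a − c₁a²). -/
lemma step_size_det (hμ : 0 < μ) (hμL : μ ≤ L) (hM : 0 < M) (ha : 0 < a)
    (hU : 0 < U) (hV : 0 < V) (hw : 0 < w) (hq : 0 < q) (hσ0 : 0 ≤ σ) (hσ1 : σ < 1)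
    (hτ1 : τ < 1) (hK : 0 < K) (hD : 0 < D) (hr : 0 < r) (hE : 0 ≤ E)
    (hMUV : M ≤ U * V * q ^ 2) (hMb : M * a ≤ b)
    (hstep : σ * K * r * V * L ^ 2 * q * (M * D * (L + μ) + q ^ 2 * U * w * L) * a ^ 2 +
      (σ * K * U * w * E * L ^ 2 * q ^ 2 + K * r * V * U * (1 - σ) * L ^ 2 * q ^ 2 / 2 +
        M * σ * K * D * E * μ * L + M / 2 * σ * w * (1 - τ) * L ^ 2 * q) * a
      ≤ M / 4 * (1 - τ) * (1 - σ) * μ)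
    (hstrict : σ = 0 →
      σ * K * r * V * L ^ 2 * q * (M * D * (L + μ) + q ^ 2 * U * w * L) * a ^ 2 +
      (σ * K * U * w * E * L ^ 2 * q ^ 2 + K * r * V * U * (1 - σ) * L ^ 2 * q ^ 2 / 2 +
        M * σ * K * D * E * μ * L + M / 2 * σ * w * (1 - τ) * L ^ 2 * q) * a
      < M / 4 * (1 - τ) * (1 - σ) * μ) :
    0 < (1 - (1 - b * μ)) * (1 - σ * (1 + a * w * (L * q))) * (1 - (τ + a * K * r * L))
      - b * (L * q) * (a * σ * D) * (a * K * r * V * L ^ 2)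
      - a * U * q ^ 2 * (a * σ * w * L) * (K * L * (E + a * r * V * (L * q)))
      - (1 - σ * (1 + a * w * (L * q))) * (a * U * q ^ 2) * (a * K * r * V * L ^ 2)
      - (1 - (1 - b * μ)) * (a * σ * D) * (K * L * (E + a * r * V * (L * q)))
      - (1 - (τ + a * K * r * L)) * (b * (L * q)) * (a * σ * w * L) := by
  obtain ⟨hW, he2, hY, hY', he3⟩ := step_size_diag hμ hμL hM ha hU hV hw hq hσ0 hσ1 hτ1 hK hD hr
    hE hMUV hstep
  have hL : 0 < L := hμ.trans_le hμL
  have hs : 0 < 1 - σ := sub_pos.2 hσ1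
  have ht : 0 < 1 - τ := sub_pos.2 hτ1
  set e2 := 1 - σ * (1 + a * w * (L * q)) with he2d
  set e3 := 1 - (τ + a * K * r * L) with he3d
  set s := 1 - σ with hsd
  set t := 1 - τ with htd
  have he2' : s / 2 < e2 := by linarith
  have he3' : t / 2 ≤ e3 := by linarith
  set X1 := (L * q) * (a * σ * D) * (a * K * r * V * L ^ 2) with hX1
  set X2 := a * U * q ^ 2 * (a * σ * w * L) * (K * L * (E + a * r * V * (L * q))) with hX2
  set Y := (a * U * q ^ 2) * (a * K * r * V * L ^ 2) with hYd
  set Z := μ * (a * σ * D) * (K * L * (E + a * r * V * (L * q))) with hZ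
  set W := (L * q) * (a * σ * w * L) with hWd
  have hX2n : 0 ≤ X2 := by positivity
  have hYn : 0 ≤ Y := by positivity
  have hWe : W < μ * e2 := by
    have h1 : W = a * σ * w * L ^ 2 * q := by rw [hWd]; ring
    have h2 : μ * (s / 2) ≤ μ * e2 := by gcongr
    linarith
  have hYle : Y ≤ M * a * μ * (t / 2) := by
    have h1 : Y = a * (K * r * V * U * L ^ 2 * q ^ 2 * a) := by rw [hYd]; ring
    have h2 := mul_le_mul_of_nonneg_left hY ha.le
    rw [h1]; linarith
  have g1 : 0 ≤ M * a * (μ * e2 - W) * (e3 - t / 2) :=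
    mul_nonneg (mul_nonneg (by positivity) (by linarith)) (by linarith)
  have g2 : 0 ≤ (e2 - s / 2) * (M * a * μ * (t / 2) - Y) :=
    mul_nonneg (by linarith) (by linarith)
  have corner : M * a * (μ * (s / 2) * (t / 2) - X1 - Z - t / 2 * W) - X2 - s / 2 * Y =
      a * (M / 4 * t * s * μ -
      (σ * K * r * V * L ^ 2 * q * (M * D * (L + μ) + q ^ 2 * U * w * L) * a ^ 2 +
      (σ * K * U * w * E * L ^ 2 * q ^ 2 + K * r * V * U * s * L ^ 2 * q ^ 2 / 2 +
        M * σ * K * D * E * μ * L + M / 2 * σ * w * t * L ^ 2 * q) * a)) := by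
    rw [hX1, hX2, hYd, hZ, hWd]; ring
  have hg : 0 < M * a * (μ * e2 * e3 - X1 - Z - e3 * W) - X2 - e2 * Y := by
    have e : M * a * (μ * e2 * e3 - X1 - Z - e3 * W) - X2 - e2 * Y =
        M * a * (μ * e2 - W) * (e3 - t / 2) + (e2 - s / 2) * (M * a * μ * (t / 2) - Y) +
        (M * a * (μ * (s / 2) * (t / 2) - X1 - Z - t / 2 * W) - X2 - s / 2 * Y) := by ring
    rw [e, corner]
    -- Strict positivity comes from the strict step size condition if σ = 0, and from the strict
    -- bound on Y and e2 > s/2 otherwise.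
    rcases hσ0.eq_or_lt with h | h
    · have := mul_pos ha (sub_pos.2 (hstrict h.symm))
      linarith
    · have h1 := mul_nonneg ha.le (sub_nonneg.2 hstep)
      have h2 : 0 < (e2 - s / 2) * (M * a * μ * (t / 2) - Y) := by
        refine mul_pos (by linarith) ?_
        have h1 : Y = a * (K * r * V * U * L ^ 2 * q ^ 2 * a) := by rw [hYd]; ring
        have h2 := mul_lt_mul_of_pos_left (hY' h) ha
        rw [h1]; linarith
      linarith
  -- The slope in b: positivity at b = Ma already forces it, as the terms free of b are nonpositive.
  have hbr : 0 ≤ μ * e2 * e3 - X1 - Z - e3 * W := by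
    refine (mul_nonneg_iff_of_pos_left (mul_pos hM ha)).1 ?_
    have : 0 ≤ e2 * Y := mul_nonneg (by linarith) hYn
    linarith
  have hfin := mul_le_mul_of_nonneg_right hMb hbr
  have e : (1 - (1 - b * μ)) * e2 * e3
      - b * (L * q) * (a * σ * D) * (a * K * r * V * L ^ 2)
      - a * U * q ^ 2 * (a * σ * w * L) * (K * L * (E + a * r * V * (L * q)))
      - e2 * (a * U * q ^ 2) * (a * K * r * V * L ^ 2)
      - (1 - (1 - b * μ)) * (a * σ * D) * (K * L * (E + a * r * V * (L * q)))
      - e3 * (b * (L * q)) * (a * σ * w * L) =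
      b * (μ * e2 * e3 - X1 - Z - e3 * W) - X2 - e2 * Y := by
    rw [hX1, hX2, hYd, hZ, hWd]; ring
  rw [e]
  linarith

/-- The step size condition forces `α' ≤ μ / L²`. -/
lemma step_size_average (hμ : 0 < μ) (hμL : μ ≤ L) (hM : 0 < M) (ha : 0 < a)
    (hU : 0 < U) (hV : 0 < V) (hw : 0 < w) (hq : 0 < q) (hσ0 : 0 ≤ σ) (hσ1 : σ < 1)
    (hτ0 : 0 ≤ τ) (hτ1 : τ < 1) (hK : 0 < K) (hD : 0 < D) (hr : 0 < r)
    {m : ℝ} (hm : 0 < m) (hMUV : M ≤ U * V * q ^ 2) (hbm : b ≤ a * m)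
    (hsE : 1 - σ ≤ E) (hmq : m ≤ (r * V + σ * w) * q) (hVK : V * q ≤ 2 * K)
    (hstep : σ * K * r * V * L ^ 2 * q * (M * D * (L + μ) + q ^ 2 * U * w * L) * a ^ 2 +
      (σ * K * U * w * E * L ^ 2 * q ^ 2 + K * r * V * U * (1 - σ) * L ^ 2 * q ^ 2 / 2 +
        M * σ * K * D * E * μ * L + M / 2 * σ * w * (1 - τ) * L ^ 2 * q) * a
      ≤ M / 4 * (1 - τ) * (1 - σ) * μ) :
    b * L ^ 2 ≤ μ := by
  have hL : 0 < L := hμ.trans_le hμL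
  have hs : 0 < 1 - σ := sub_pos.2 hσ1
  have ht : 0 < 1 - τ := sub_pos.2 hτ1
  have hE : 0 ≤ E := hs.le.trans hsE
  have n0 : 0 ≤ σ * K * r * V * L ^ 2 * q * (M * D * (L + μ) + q ^ 2 * U * w * L) * a ^ 2 := by
    positivity
  have n3 : 0 ≤ M * σ * K * D * E * μ * L * a := by positivity
  have n4 : 0 ≤ M / 2 * σ * w * (1 - τ) * L ^ 2 * q * a := by positivity
  -- Replacing E by its lower bound 1 − σ makes 1 − σ a common factor of the two summands kept, so
  -- it cancels.
  have n1 : σ * K * U * w * (1 - σ) * L ^ 2 * q ^ 2 * a ≤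
      σ * K * U * w * E * L ^ 2 * q ^ 2 * a := by gcongr
  have n5 : M / 4 * (1 - τ) * (1 - σ) * μ ≤ M / 4 * 1 * (1 - σ) * μ := by
    gcongr; linarith
  have h1 : (1 - σ) * (a * K * U * L ^ 2 * q ^ 2 * (σ * w + r * V / 2)) ≤
      (1 - σ) * (M / 4 * μ) := by linarith
  have h2 := le_of_mul_le_mul_left h1 hs
  have h3 : a * K * U * L ^ 2 * q * (m / 2) ≤ M / 4 * μ := by
    refine le_trans ?_ h2
    have : a * K * U * L ^ 2 * q * (m / 2) ≤ a * K * U * L ^ 2 * q * ((r * V + σ * w) * q / 2) := by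
      gcongr
    have n6 : 0 ≤ a * K * U * L ^ 2 * q ^ 2 * (σ * w) := by positivity
    linarith
  have h4 : a * (V * q / 2) * U * L ^ 2 * q * (m / 2) ≤ a * K * U * L ^ 2 * q * (m / 2) := by
    gcongr; linarith
  have h5 : M / 4 * μ ≤ U * V * q ^ 2 / 4 * μ := by gcongr
  have h6 : (U * V * q ^ 2 / 4) * (a * m * L ^ 2) ≤ (U * V * q ^ 2 / 4) * μ := by linarith
  have h7 := le_of_mul_le_mul_left h6 (by positivity)
  have h8 : b * L ^ 2 ≤ a * m * L ^ 2 := by gcongr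
  linarith

end StepSize

/-! ### Algebra of stacked vectors -/

section Stack

variable {n p : ℕ}

lemma mulRows_add (W : Matrix (Fin n) (Fin n) ℝ) (x y : Fin n → EuclideanSpace ℝ (Fin p)) :
    mulRows W (x + y) = mulRows W x + mulRows W y := by
  ext1 i; simp [mulRows, Finset.sum_add_distrib]

lemma mulRows_sub (W : Matrix (Fin n) (Fin n) ℝ) (x y : Fin n → EuclideanSpace ℝ (Fin p)) :
    mulRows W (x - y) = mulRows W x - mulRows W y := by
  ext1 i; simp [mulRows, Finset.sum_sub_distrib, smul_sub]

lemma sub_mulRows (W W' : Matrix (Fin n) (Fin n) ℝ) (x : Fin n → EuclideanSpace ℝ (Fin p)) :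
    mulRows (W - W') x = mulRows W x - mulRows W' x := by
  ext1 i; simp [mulRows, Finset.sum_sub_distrib, sub_smul]

lemma one_mulRows (x : Fin n → EuclideanSpace ℝ (Fin p)) : mulRows 1 x = x := by
  ext1 i; simp [mulRows, Matrix.one_apply]

lemma diagonal_mulRows (d : Fin n → ℝ) (x : Fin n → EuclideanSpace ℝ (Fin p)) :
    mulRows (diagonal d) x = fun i => d i • x i := by
  ext1 i; simp [mulRows, Matrix.diagonal_apply]

lemma mulRows_rankOne (W : Matrix (Fin n) (Fin n) ℝ) (c : Fin n → ℝ)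
    (a : EuclideanSpace ℝ (Fin p)) :
    mulRows W (fun i => c i • a) = fun i => (W *ᵥ c) i • a := by
  ext1 i; simp only [mulRows, mulVec_apply_eq_sum, Finset.sum_smul, smul_smul]

lemma projR_mulRows (u : Fin n → ℝ) (x : Fin n → EuclideanSpace ℝ (Fin p)) :
    mulRows (projR u) x = fun _ => avg u x := by
  ext1 i
  simp only [mulRows, projR, of_apply, avg, Finset.smul_sum, smul_smul]
  exact Finset.sum_congr rfl fun j _ => by rw [div_eq_inv_mul]

lemma projC_mulRows (v : Fin n → ℝ) (x : Fin n → EuclideanSpace ℝ (Fin p)) :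
    mulRows (projC v) x = fun i => v i • avg (fun _ => 1) x := by
  ext1 i
  simp only [mulRows, projC, of_apply, avg, Finset.smul_sum, smul_smul]
  exact Finset.sum_congr rfl fun j _ => by rw [div_eq_mul_inv, mul_one]

lemma avg_add (w : Fin n → ℝ) (x y : Fin n → EuclideanSpace ℝ (Fin p)) :
    avg w (x + y) = avg w x + avg w y := by
  simp [avg, Finset.sum_add_distrib]

lemma avg_sub (w : Fin n → ℝ) (x y : Fin n → EuclideanSpace ℝ (Fin p)) :
    avg w (x - y) = avg w x - avg w y := by
  simp [avg, Finset.sum_sub_distrib, smul_sub]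

lemma avg_mulRows (w : Fin n → ℝ) (W : Matrix (Fin n) (Fin n) ℝ)
    (x : Fin n → EuclideanSpace ℝ (Fin p)) : avg w (mulRows W x) = avg (w ᵥ* W) x := by
  simp only [avg, mulRows, Finset.smul_sum, smul_smul, vecMul, dotProduct, Finset.sum_smul]
  rw [Finset.sum_comm]

lemma stackNorm_sub_avg_eq (N : Seminorm ℝ (Fin n → ℝ)) (u : Fin n → ℝ)
    (x : Fin n → EuclideanSpace ℝ (Fin p)) :
    stackNorm N (fun i => x i - avg u x) = stackNorm N (x - mulRows (projR u) x) := by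
  rw [projR_mulRows]; rfl

lemma stackNorm_sub_smul_avg_eq (N : Seminorm ℝ (Fin n → ℝ)) (v : Fin n → ℝ)
    (x : Fin n → EuclideanSpace ℝ (Fin p)) :
    stackNorm N (fun i => x i - v i • avg (fun _ => 1) x) =
      stackNorm N (x - mulRows (projC v) x) := by
  rw [projC_mulRows]; rfl

lemma stackNorm_le_mul {N N' : Seminorm ℝ (Fin n → ℝ)} {c : ℝ} (hc : 0 ≤ c)
    (h : ∀ w, N w ≤ c * N' w) (x : Fin n → EuclideanSpace ℝ (Fin p)) :
    stackNorm N x ≤ c * stackNorm N' x :=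
  stackNorm_le_of_columns hc fun _ => h _

lemma stackNorm_euclidean_le {N : Seminorm ℝ (Fin n → ℝ)} (h : ∀ w, norm2 w ≤ N w)
    (x : Fin n → EuclideanSpace ℝ (Fin p)) :
    stackNorm (euclideanSeminorm n) x ≤ stackNorm N x := by
  simpa using stackNorm_le_mul (N := euclideanSeminorm n) (N' := N) zero_le_one
    (by simpa using h) x

lemma stackNorm_euclidean_mono {c : ℝ} (hc : 0 ≤ c) {x y : Fin n → EuclideanSpace ℝ (Fin p)}
    (h : ∀ i, ‖x i‖ ≤ c * ‖y i‖) :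
    stackNorm (euclideanSeminorm n) x ≤ c * stackNorm (euclideanSeminorm n) y := by
  rw [stackNorm_euclidean_eq, stackNorm_euclidean_eq, ← abs_of_nonneg hc, ← norm2_smul]
  refine norm2_le_of_abs_le fun i => ?_
  simp only [Pi.smul_apply, smul_eq_mul]
  rw [abs_norm, abs_mul, abs_norm, abs_of_nonneg hc]
  exact h i

lemma stackNorm_euclidean_mulRows_le (W : Matrix (Fin n) (Fin n) ℝ)
    (x : Fin n → EuclideanSpace ℝ (Fin p)) :
    stackNorm (euclideanSeminorm n) (mulRows W x) ≤
      matNorm2 W * stackNorm (euclideanSeminorm n) x := by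
  rw [← matNorm_euclidean]
  exact stackNorm_mulRows_le (fun _ => le_rfl) W x

lemma norm_avg_le (w : Fin n → ℝ) (x : Fin n → EuclideanSpace ℝ (Fin p)) :
    ‖avg w x‖ ≤ norm2 w / n * stackNorm (euclideanSeminorm n) x := by
  rw [avg, norm_smul, norm_inv, Real.norm_natCast, div_mul_eq_mul_div, div_eq_inv_mul]
  exact mul_le_mul_of_nonneg_left (norm_weighted_sum_le w x) (by positivity)

end Stack

lemma norm_le_alphaHat {n : ℕ} {α : Fin n → ℝ} (hα : ∀ i, 0 ≤ α i) : ‖α‖ ≤ alphaHat α := by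
  refine (pi_norm_le_iff_of_nonneg (Real.iSup_nonneg hα)).2 fun i => ?_
  rw [Real.norm_eq_abs, abs_of_nonneg (hα i)]
  exact le_ciSup (Set.finite_range α).bddAbove i

lemma le_alphaHat {n : ℕ} (α : Fin n → ℝ) (i : Fin n) : α i ≤ alphaHat α :=
  le_ciSup (Set.finite_range α).bddAbove i

/-! ### The one-step recursion -/

section Recursion

variable {n p : ℕ} {f : Fin n → EuclideanSpace ℝ (Fin p) → ℝ}
  {R C : Matrix (Fin n) (Fin n) ℝ} {α : Fin n → ℝ} {u v : Fin n → ℝ}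
  {x y : ℕ → Fin n → EuclideanSpace ℝ (Fin p)}

/-- The stack of the local gradients. -/
noncomputable def stackGrad (f : Fin n → EuclideanSpace ℝ (Fin p) → ℝ)
    (z : Fin n → EuclideanSpace ℝ (Fin p)) : Fin n → EuclideanSpace ℝ (Fin p) :=
  fun i => gradient (f i) (z i)

lemma IsTrajectory.x_succ (h : IsTrajectory f R C α x y) (k : ℕ) :
    x (k + 1) = mulRows R (x k - mulRows (diagonal α) (y k)) := by
  rw [diagonal_mulRows]
  exact funext fun i => h.step_x k i

lemma IsTrajectory.y_succ (h : IsTrajectory f R C α x y) (k : ℕ) :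
    y (k + 1) = mulRows C (y k) + (stackGrad f (x (k + 1)) - stackGrad f (x k)) := by
  refine funext fun i => (h.step_y k i).trans ?_
  rw [add_sub_assoc]
  rfl

lemma one_vecMul_of_colStochastic (hC : C ∈ colStochastic ℝ (Fin n)) :
    (fun _ => 1) ᵥ* C = fun _ => 1 := hC.2

/-- The tracking invariant: mixing by C preserves column sums, so the gradient increments telescope
from y 0. -/
lemma IsTrajectory.avg_y (h : IsTrajectory f R C α x y) (hC : C ∈ colStochastic ℝ (Fin n))
    (k : ℕ) : avg (fun _ => 1) (y k) = avg (fun _ => 1) (stackGrad f (x k)) := by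
  induction k with
  | zero => congr 1; exact funext h.init
  | succ k ih =>
    rw [h.y_succ, avg_add, avg_sub, avg_mulRows, one_vecMul_of_colStochastic hC, ih]
    abel

lemma IsTrajectory.avg_x_succ (h : IsTrajectory f R C α x y) (hu : IsLeftPerron R u) (k : ℕ) :
    avg u (x (k + 1)) = avg u (x k) - avg u (mulRows (diagonal α) (y k)) := by
  rw [h.x_succ, avg_mulRows, hu.eigen, avg_sub]

lemma projR_mulVec_one (hn : 0 < n) (hu : ∑ i, u i = n) :
    projR u *ᵥ (fun _ => 1) = fun _ => 1 := by
  have hn' : (n : ℝ) ≠ 0 := by exact_mod_cast hn.ne'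
  ext i
  rw [mulVec_apply_eq_sum]
  simp [projR, ← Finset.sum_div, hu, hn']

lemma projC_mulVec (hn : 0 < n) {w : Fin n → ℝ} (hw : ∑ i, w i = n) :
    projC v *ᵥ w = v := by
  have hn' : (n : ℝ) ≠ 0 := by exact_mod_cast hn.ne'
  ext i
  rw [mulVec_apply_eq_sum]
  simp [projC, ← Finset.mul_sum, hw, hn']

/-- R and 1uᵀ/n both fix the all-ones vector, so their difference annihilates consensus stacks. -/
lemma mulRows_sub_projR (hn : 0 < n) (hR : R *ᵥ (fun _ => 1) = fun _ => 1)
    (hu : ∑ i, u i = n) (z : Fin n → EuclideanSpace ℝ (Fin p)) (w : Fin n → ℝ) :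
    mulRows (R - projR u) z = mulRows (R - projR u) (z - mulRows (projR w) z) := by
  have h : mulRows (projR w) z = fun i => (fun _ => (1 : ℝ)) i • avg w z := by
    rw [projR_mulRows]; simp
  rw [mulRows_sub, h, mulRows_rankOne, sub_mulVec, hR, projR_mulVec_one hn hu]
  ext1 i
  simp

lemma IsTrajectory.consensus_succ (h : IsTrajectory f R C α x y) (hn : 0 < n)
    (hR : R *ᵥ (fun _ => 1) = fun _ => 1) (hu : IsLeftPerron R u) (k : ℕ) :
    x (k + 1) - mulRows (projR u) (x (k + 1)) =
      mulRows (R - projR u) (x k - mulRows (projR u) (x k)) -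
        mulRows (R - projR u) (mulRows (diagonal α) (y k)) := by
  rw [← mulRows_sub_projR hn hR hu.sum_eq, ← mulRows_sub, sub_mulRows, ← h.x_succ, projR_mulRows,
    projR_mulRows, h.x_succ, avg_mulRows, hu.eigen]

/-- C and v1ᵀ/n both fix v, so C − v1ᵀ/n ignores the component along v; and v1ᵀC = v1ᵀ. -/
lemma IsTrajectory.tracking_succ (h : IsTrajectory f R C α x y) (hn : 0 < n)
    (hC : C ∈ colStochastic ℝ (Fin n)) (hv : IsRightPerron C v) (k : ℕ) :
    y (k + 1) - mulRows (projC v) (y (k + 1)) =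
      mulRows (C - projC v) (y k - mulRows (projC v) (y k)) +
        mulRows (1 - projC v) (stackGrad f (x (k + 1)) - stackGrad f (x k)) := by
  have e : mulRows (C - projC v) (mulRows (projC v) (y k)) = 0 := by
    rw [projC_mulRows, mulRows_rankOne, sub_mulVec, hv.eigen, projC_mulVec hn hv.sum_eq]
    ext1 i; simp
  have e2 : mulRows (projC v) (mulRows C (y k)) = mulRows (projC v) (y k) := by
    rw [projC_mulRows, projC_mulRows, avg_mulRows, one_vecMul_of_colStochastic hC]
  rw [mulRows_sub, e, h.y_succ, mulRows_add, e2, sub_mulRows, sub_mulRows, one_mulRows]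
  abel

lemma IsTrajectory.x_succ_sub (h : IsTrajectory f R C α x y)
    (hR : R *ᵥ (fun _ => 1) = fun _ => 1) (k : ℕ) :
    x (k + 1) - x k = mulRows (R - 1) (x k - mulRows (projR u) (x k)) -
      mulRows R (mulRows (diagonal α) (y k)) := by
  have e : mulRows (R - 1) (mulRows (projR u) (x k)) = 0 := by
    have h : mulRows (projR u) (x k) = fun i => (fun _ => (1 : ℝ)) i • avg u (x k) := by
      rw [projR_mulRows]; simp
    rw [h, mulRows_rankOne, sub_mulVec, hR, one_mulVec]
    ext1 i; simp
  rw [mulRows_sub, e, h.x_succ, mulRows_sub, sub_mulRows, one_mulRows]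
  abel

/-- Splitting the scaled direction into the tracking error and the averaged gradient. -/
lemma stackNorm_diagonal_le {N : Seminorm ℝ (Fin n → ℝ)}
    (hN : ∀ w, norm2 w ≤ N w) (hd : matNorm N (diagonal α) = matNorm2 (diagonal α))
    (hα : ∀ i, 0 ≤ α i) (v : Fin n → ℝ) (z : Fin n → EuclideanSpace ℝ (Fin p)) :
    stackNorm N (mulRows (diagonal α) z) ≤ alphaHat α *
      (stackNorm N (z - mulRows (projC v) z) + N v * ‖avg (fun _ => 1) z‖) := by
  refine (stackNorm_mulRows_le hN _ _).trans ?_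
  have h1 : matNorm N (diagonal α) ≤ alphaHat α := by
    rw [hd, matNorm2_diagonal]; exact norm_le_alphaHat hα
  refine mul_le_mul h1 ?_ (stackNorm_nonneg _ _) ((matNorm_nonneg _ _).trans h1)
  rw [← stackNorm_rankOne, ← projC_mulRows]
  refine le_trans (le_of_eq ?_) (stackNorm_add_le _ _ _)
  rw [sub_add_cancel]

end Recursion

/-! ### Lipschitz bounds for stacked and averaged gradients. -/

section Gradient

variable {n p : ℕ} {f : Fin n → EuclideanSpace ℝ (Fin p) → ℝ} {μ L : ℝ}

lemma stackNorm_stackGrad_sub_le (hf : ∀ i, StronglyConvexSmooth μ L (f i)) (hL : 0 ≤ L)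
    (z z' : Fin n → EuclideanSpace ℝ (Fin p)) :
    stackNorm (euclideanSeminorm n) (stackGrad f z - stackGrad f z') ≤
      L * stackNorm (euclideanSeminorm n) (z - z') :=
  stackNorm_euclidean_mono hL fun i => (hf i).lipschitz (z i) (z' i)

/-- The averaged local gradient is close to the gradient of the averaged objective. -/
lemma norm_avg_stackGrad_sub_le (hn : 0 < n) (hf : ∀ i, StronglyConvexSmooth μ L (f i))
    (hL : 0 ≤ L) (u : Fin n → ℝ) (z : Fin n → EuclideanSpace ℝ (Fin p)) :
    ‖avg (fun _ => 1) (stackGrad f z) -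
        gradient (fun w => (n : ℝ)⁻¹ * ∑ i, f i w) (avg u z)‖ ≤
      L / √n * stackNorm (euclideanSeminorm n) (z - mulRows (projR u) z) := by
  have hn' : (0 : ℝ) < n := by exact_mod_cast hn
  have e : gradient (fun w => (n : ℝ)⁻¹ * ∑ i, f i w) (avg u z) =
      avg (fun _ => 1) (stackGrad f (mulRows (projR u) z)) := by
    rw [(gradient_average (fun i => (hf i).differentiable) _).gradient, projR_mulRows]
    simp [avg, stackGrad]
  rw [e, ← avg_sub]
  refine (norm_avg_le _ _).trans ?_
  have h1 : norm2 (fun _ : Fin n => (1 : ℝ)) = √n := by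
    rw [← Real.sqrt_sq (norm2_nonneg _)]
    congr 1
    exact norm2_one_sq
  have h2 := stackNorm_stackGrad_sub_le hf hL z (mulRows (projR u) z)
  have h3 : √(n : ℝ) / n = 1 / √n := by
    rw [div_eq_div_iff hn'.ne' (Real.sqrt_pos.2 hn').ne', Real.mul_self_sqrt hn'.le, one_mul]
  rw [h1, h3]
  calc 1 / √n * stackNorm (euclideanSeminorm n) (stackGrad f z - stackGrad f (mulRows (projR u) z))
      ≤ 1 / √n * (L * stackNorm (euclideanSeminorm n) (z - mulRows (projR u) z)) := by gcongr
    _ = _ := by ring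

lemma gradient_average_eq_zero {xstar : EuclideanSpace ℝ (Fin p)} (hx : ∀ z, ∑ i, f i xstar ≤ ∑ i, f i z) :
    gradient (fun w => (n : ℝ)⁻¹ * ∑ i, f i w) xstar = 0 := by
  have h : IsLocalMin (fun w => (n : ℝ)⁻¹ * ∑ i, f i w) xstar :=
    Eventually.of_forall fun z => mul_le_mul_of_nonneg_left (hx z) (by positivity)
  rw [gradient, h.fderiv_eq_zero, map_zero]

end Gradient

/-! ### A priori inequalities between the constants. -/

section Bounds

variable {n : ℕ} {R C : Matrix (Fin n) (Fin n) ℝ} {u v : Fin n → ℝ}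
  {NR NC : Seminorm ℝ (Fin n → ℝ)} {δC2 δRC : ℝ}

lemma norm2_pos {w : Fin n → ℝ} (hw : w ≠ 0) : 0 < norm2 w :=
  (norm2_nonneg w).lt_of_ne fun h => hw (norm2_eq_zero.1 h.symm)

lemma norm2_one : norm2 (fun _ : Fin n => (1 : ℝ)) = √n := by
  rw [← Real.sqrt_sq (norm2_nonneg _)]
  congr 1
  exact norm2_one_sq

lemma ne_zero_of_sum_eq (hn : 0 < n) {w : Fin n → ℝ} (hw : ∑ i, w i = n) : w ≠ 0 := by
  rintro rfl
  have : (n : ℝ) ≠ 0 := by exact_mod_cast hn.ne'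
  simp at hw
  exact this hw.symm

lemma one_le_matNorm2 (hn : 0 < n) (hR : R *ᵥ (fun _ => 1) = fun _ => 1) : 1 ≤ matNorm2 R := by
  have h := norm2_mulVec_le R (fun _ => 1)
  have hpos : 0 < norm2 (fun _ : Fin n => (1 : ℝ)) := by
    rw [norm2_one]; exact Real.sqrt_pos.2 (by exact_mod_cast hn)
  rw [hR] at h
  exact le_of_mul_le_mul_right (by linarith) hpos

/-- The nonzero sum-zero vectors exist as soon as there are two nodes. -/
lemma exists_orthogonal (hn : 2 ≤ n) (u : Fin n → ℝ) :
    ∃ w : Fin n → ℝ, w ≠ 0 ∧ ∑ j, u j * w j = 0 := by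
  set i : Fin n := ⟨0, by omega⟩
  set j : Fin n := ⟨1, by omega⟩
  have hij : i ≠ j := by simp [i, j]
  by_cases h : u i = 0
  · refine ⟨Pi.single i 1, by simp, ?_⟩
    simp [Pi.single_apply, h]
  · refine ⟨u j • Pi.single i 1 - u i • Pi.single j 1, fun h0 => h ?_, ?_⟩
    · have := congr_fun h0 j
      simpa [hij.symm] using this
    · simp [Pi.single_apply, mul_sub, Finset.sum_sub_distrib]
      ring

/-- A nonzero vector with zero sum is fixed by 1 − v1ᵀ/n. -/
lemma one_le_c0 (hn : 2 ≤ n) (hNC : ∀ w, norm2 w ≤ NC w) (v : Fin n → ℝ) : 1 ≤ c0 NC v := by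
  obtain ⟨w, hw, h0⟩ := exists_orthogonal hn (fun _ => 1)
  have e : (1 - projC v) *ᵥ w = w := by
    rw [sub_mulVec, one_mulVec]
    ext i
    rw [Pi.sub_apply, mulVec_apply_eq_sum]
    simp only [one_mul] at h0
    simp [projC, ← Finset.mul_sum, h0]
  have h := apply_mulVec_le hNC (1 - projC v) w
  rw [e] at h
  have hpos := (norm2_pos hw).trans_le (hNC w)
  exact le_of_mul_le_mul_right (by rw [one_mul]; exact h) hpos

lemma one_le_of_le_mul (hn : 0 < n) (hNC : ∀ w, norm2 w ≤ NC w)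
    (hδ : ∀ w, NC w ≤ δC2 * norm2 w) : 1 ≤ δC2 := by
  have hpos : 0 < norm2 (fun _ : Fin n => (1 : ℝ)) := by
    rw [norm2_one]; exact Real.sqrt_pos.2 (by exact_mod_cast hn)
  refine le_of_mul_le_mul_right ?_ hpos
  rw [one_mul]
  exact (hNC _).trans (hδ _)

lemma pos_of_le_mul (hn : 0 < n) (hNR : ∀ w, norm2 w ≤ NR w)
    (hδ : ∀ w, NR w ≤ δRC * NC w) : 0 < δRC := by
  have hpos : 0 < norm2 (fun _ : Fin n => (1 : ℝ)) := by
    rw [norm2_one]; exact Real.sqrt_pos.2 (by exact_mod_cast hn)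
  exact pos_of_mul_pos_left (hpos.trans_le ((hNR _).trans (hδ _))) (apply_nonneg _ _)

/-- The oblique projection `1 - v 1ᵀ / n` is at least as large as its direction. -/
lemma norm2_le_c0 (hn : 2 ≤ n) (hNC : ∀ w, norm2 w ≤ NC w)
    (hδ : ∀ w, NC w ≤ δC2 * norm2 w) (v : Fin n → ℝ) :
    norm2 v ≤ 2 * (c0 NC v * δC2) * √n := by
  have hc := one_le_c0 hn hNC v
  have hd := one_le_of_le_mul (by omega) hNC hδ
  set o : Fin n → ℝ := fun _ => 1
  have e : (1 - projC v) *ᵥ o = o - v := by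
    rw [sub_mulVec, one_mulVec, projC_mulVec (by omega) (by simp [o])]
  have h1 : norm2 (o - v) ≤ c0 NC v * (δC2 * √n) := by
    rw [← norm2_one, ← e]
    refine (hNC _).trans ((apply_mulVec_le hNC _ _).trans ?_)
    exact mul_le_mul_of_nonneg_left (hδ _) (matNorm_nonneg _ _)
  have h2 : norm2 v ≤ norm2 o + norm2 (o - v) := by
    have := map_sub_le_add (euclideanSeminorm n) o (o - v)
    simpa using this
  have h3 : √(n : ℝ) ≤ c0 NC v * δC2 * √n :=
    le_mul_of_one_le_left (Real.sqrt_nonneg _) (by nlinarith)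
  rw [norm2_one] at h2
  linarith

/-- The mixing rate cannot be faster than the distance of `R` from the identity allows. -/
lemma one_sub_sigmaR_le (hn : 2 ≤ n) (hu : IsLeftPerron R u) (hNR : ∀ w, norm2 w ≤ NR w) :
    1 - sigmaR NR R u ≤ matNorm2 (R - 1) := by
  by_contra! hlt
  set σ := sigmaR NR R u with hσ
  set η := 1 - matNorm2 (R - 1) with hη
  have hσ0 : 0 ≤ σ := matNorm_nonneg _ _
  have hση : σ < η := by linarith
  have hη0 : 0 < η := hσ0.trans_lt hση
  obtain ⟨w, hw, h0⟩ := exists_orthogonal hn u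
  -- On vectors orthogonal to u, a step of R keeps at least the fraction η of the Euclidean norm but
  -- at most the fraction σ of `NR`. As `NR` dominates the Euclidean norm, σ < η is impossible in
  -- the long run.
  have key : ∀ k : ℕ, ∃ z : Fin n → ℝ, ∑ j, u j * z j = 0 ∧ η ^ k * norm2 w ≤ norm2 z ∧
      NR z ≤ σ ^ k * NR w := fun k => by
    induction k with
    | zero => exact ⟨w, h0, by simp, by simp⟩
    | succ k ih =>
      obtain ⟨z, hz0, hz1, hz2⟩ := ih
      refine ⟨R *ᵥ z, (hu.sum_mulVec z).trans hz0, ?_, ?_⟩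
      · have h1 : norm2 z ≤ norm2 (R *ᵥ z) + norm2 ((R - 1) *ᵥ z) := by
          have := map_sub_le_add (euclideanSeminorm n) (R *ᵥ z) ((R - 1) *ᵥ z)
          rw [sub_mulVec R 1, one_mulVec, sub_sub_cancel] at this
          rwa [sub_mulVec, one_mulVec]
        have h2 := norm2_mulVec_le (R - 1) z
        have h3 := mul_le_mul_of_nonneg_left hz1 hη0.le
        rw [pow_succ]
        linarith
      · have e : R *ᵥ z = (R - projR u) *ᵥ z := by
          ext i; rw [sub_projR_mulVec_apply, hz0, zero_div, sub_zero]
        rw [e, pow_succ']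
        refine (apply_mulVec_le hNR _ _).trans ?_
        rw [mul_assoc]
        exact mul_le_mul_of_nonneg_left hz2 hσ0
  have hlim : Tendsto (fun k : ℕ => (σ / η) ^ k * NR w) atTop (nhds 0) := by
    simpa using (tendsto_pow_atTop_nhds_zero_of_lt_one (div_nonneg hσ0 hη0.le)
      ((div_lt_one hη0).2 hση)).mul_const (NR w)
  have hle : norm2 w ≤ 0 := ge_of_tendsto' hlim fun k => by
    obtain ⟨z, -, hz1, hz2⟩ := key k
    rw [div_pow, div_mul_eq_mul_div, le_div_iff₀ (pow_pos hη0 k)]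
    linarith [hNR z]
  exact (norm2_pos hw).not_ge hle

/-- The constant vector with entries uᵀv/n is the projection of v, that is, Rv − (R − 1uᵀ/n)v; take
Euclidean norms. -/
lemma dotProduct_perron_le (hNR : ∀ w, norm2 w ≤ NR w)
    (hm : 0 ≤ (∑ j, u j * v j) / n) :
    (∑ j, u j * v j) / n * √n ≤ matNorm2 R * norm2 v + sigmaR NR R u * NR v := by
  set m := (∑ j, u j * v j) / n
  have e : m • (fun _ => 1) = R *ᵥ v - (R - projR u) *ᵥ v := by
    ext i
    rw [Pi.sub_apply, sub_projR_mulVec_apply]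
    simp [m]
  have h1 : norm2 (m • fun _ : Fin n => (1 : ℝ)) = m * √n := by
    rw [norm2_smul, norm2_one, abs_of_nonneg hm]
  rw [← h1, e]
  refine (map_sub_le_add (euclideanSeminorm n) (R *ᵥ v) ((R - projR u) *ᵥ v)).trans ?_
  exact add_le_add (norm2_mulVec_le R v) ((hNR _).trans (apply_mulVec_le hNR _ _))

lemma alphaPrime_le {α : Fin n → ℝ} (hu : ∀ i, 0 ≤ u i) (hv : ∀ i, 0 ≤ v i) :
    alphaPrime u v α ≤ alphaHat α * ((∑ j, u j * v j) / n) := by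
  rw [alphaPrime, mul_div_assoc', Finset.mul_sum]
  refine div_le_div_of_nonneg_right (Finset.sum_le_sum fun i _ => ?_) (Nat.cast_nonneg n)
  have := mul_le_mul_of_nonneg_right (le_alphaHat α i) (mul_nonneg (hu i) (hv i))
  linarith

end Bounds

/-! ### The error system -/

section ErrorSystem

variable {n p : ℕ} {f : Fin n → EuclideanSpace ℝ (Fin p) → ℝ} {μ L : ℝ}
  {R C : Matrix (Fin n) (Fin n) ℝ} {α : Fin n → ℝ} {u v : Fin n → ℝ}
  {x y : ℕ → Fin n → EuclideanSpace ℝ (Fin p)} {xstar : EuclideanSpace ℝ (Fin p)}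
  {NR NC : Seminorm ℝ (Fin n → ℝ)} {δC2 δRC : ℝ}

/-- The optimality, consensus and tracking errors. -/
noncomputable def errors (u v : Fin n → ℝ) (NR NC : Seminorm ℝ (Fin n → ℝ))
    (xstar : EuclideanSpace ℝ (Fin p)) (x y : Fin n → EuclideanSpace ℝ (Fin p)) : Fin 3 → ℝ :=
  ![‖avg u x - xstar‖, stackNorm NR (x - mulRows (projR u) x),
    stackNorm NC (y - mulRows (projC v) y)]

lemma errors_nonneg (i : Fin 3) (x y : Fin n → EuclideanSpace ℝ (Fin p)) :
    0 ≤ errors u v NR NC xstar x y i := by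
  fin_cases i
  · exact norm_nonneg _
  · exact stackNorm_nonneg _ _
  · exact stackNorm_nonneg _ _

/-- This is where α' arises: it is the effective step length of the average when y has the form v ȳ.
-/
lemma avg_diagonal_projC (z : Fin n → EuclideanSpace ℝ (Fin p)) :
    avg u (mulRows (diagonal α) (mulRows (projC v) z)) =
      alphaPrime u v α • avg (fun _ => 1) z := by
  rw [projC_mulRows, diagonal_mulRows, alphaPrime, avg, div_eq_inv_mul, mul_smul, Finset.sum_smul]
  simp only [smul_smul, mul_assoc]

lemma IsTrajectory.norm_avg_y_sub_le (h : IsTrajectory f R C α x y) (hn : 0 < n)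
    (hf : ∀ i, StronglyConvexSmooth μ L (f i)) (hL : 0 ≤ L) (hC : C ∈ colStochastic ℝ (Fin n))
    (hNR : ∀ w, norm2 w ≤ NR w) (k : ℕ) :
    ‖avg (fun _ => 1) (y k) - gradient (fun w => (n : ℝ)⁻¹ * ∑ i, f i w) (avg u (x k))‖ ≤
      L / √n * stackNorm NR (x k - mulRows (projR u) (x k)) := by
  rw [h.avg_y hC]
  refine (norm_avg_stackGrad_sub_le hn hf hL u (x k)).trans ?_
  exact mul_le_mul_of_nonneg_left (stackNorm_euclidean_le hNR _) (by positivity)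

lemma IsTrajectory.norm_avg_y_le (h : IsTrajectory f R C α x y) (hn : 0 < n)
    (hf : ∀ i, StronglyConvexSmooth μ L (f i)) (hL : 0 ≤ L) (hC : C ∈ colStochastic ℝ (Fin n))
    (hNR : ∀ w, norm2 w ≤ NR w) (hx : ∀ z, ∑ i, f i xstar ≤ ∑ i, f i z) (k : ℕ) :
    ‖avg (fun _ => 1) (y k)‖ ≤ L * ‖avg u (x k) - xstar‖ +
      L / √n * stackNorm NR (x k - mulRows (projR u) (x k)) := by
  have h1 := h.norm_avg_y_sub_le (u := u) hn hf hL hC hNR k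
  have h2 := (StronglyConvexSmooth.average hn hf).lipschitz (avg u (x k)) xstar
  rw [gradient_average_eq_zero hx, sub_zero] at h2
  have h3 := norm_le_norm_sub_add (avg (fun _ => 1) (y k))
    (gradient (fun w => (n : ℝ)⁻¹ * ∑ i, f i w) (avg u (x k)))
  linarith

/-- Each row is an exact identity for the new error followed by the triangle inequality; the norm of
ȳ is bounded through the first two errors because the average gradient vanishes at the minimizer. -/
lemma IsTrajectory.errors_succ_le (h : IsTrajectory f R C α x y) (hn : 0 < n)
    (hf : ∀ i, StronglyConvexSmooth μ L (f i)) (hμ : 0 < μ) (hμL : μ ≤ L)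
    (hx : ∀ z, ∑ i, f i xstar ≤ ∑ i, f i z)
    (hRC : StochasticPair R C) (hu : IsLeftPerron R u) (hv : IsRightPerron C v)
    (hNR : IsContractionNorm (R - projR u) NR) (hNC : IsContractionNorm (C - projC v) NC)
    (hδ0 : 0 ≤ δC2) (hδ0' : 0 ≤ δRC)
    (hδ : ∀ w, NC w ≤ δC2 * norm2 w) (hδ' : ∀ w, NR w ≤ δRC * NC w)
    (hα : ∀ i, 0 ≤ α i) (hb : 0 ≤ alphaPrime u v α) (hbL : alphaPrime u v α * L ^ 2 ≤ μ) (k : ℕ)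
    (i : Fin 3) :
    errors u v NR NC xstar (x (k + 1)) (y (k + 1)) i ≤
      (transition μ L R C u v α NR NC δC2 δRC *ᵥ errors u v NR NC xstar (x k) (y k)) i := by
  have hL : 0 < L := hμ.trans_le hμL
  have hR : R *ᵥ (fun _ => 1) = fun _ => 1 := hRC.row.2
  have hNR' := hNR.norm2_le
  have hNC' := hNC.norm2_le
  set e1 := ‖avg u (x k) - xstar‖ with he1
  set e2 := stackNorm NR (x k - mulRows (projR u) (x k)) with he2
  set e3 := stackNorm NC (y k - mulRows (projC v) (y k)) with he3
  set a := alphaHat α with ha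
  set b := alphaPrime u v α with hbd
  set g := fun w => (n : ℝ)⁻¹ * ∑ i, f i w with hg
  set yb := avg (fun _ => 1) (y k) with hyb
  have ha0 : 0 ≤ a := Real.iSup_nonneg hα
  have hy1 : ‖yb - gradient g (avg u (x k))‖ ≤ L / √n * e2 := h.norm_avg_y_sub_le hn hf hL.le
    hRC.col hNR' k
  have hy2 : ‖yb‖ ≤ L * e1 + L / √n * e2 := h.norm_avg_y_le hn hf hL.le hRC.col hNR' hx k
  have hY2 : stackNorm (euclideanSeminorm n) (y k - mulRows (projC v) (y k)) ≤ e3 :=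
    stackNorm_euclidean_le hNC' _
  have hX2 : stackNorm (euclideanSeminorm n) (x k - mulRows (projR u) (x k)) ≤ e2 :=
    stackNorm_euclidean_le hNR' _
  have hr0 := matNorm2_nonneg R
  have hE0 := matNorm2_nonneg (R - 1)
  have hσ0 : 0 ≤ sigmaR NR R u := matNorm_nonneg _ _
  have hc0 : 0 ≤ c0 NC v := matNorm_nonneg _ _
  rw [mulVec_apply_eq_sum, Fin.sum_univ_three]
  fin_cases i
  · -- optimality error
    -- From bL² ≤ μ ≤ L one gets bL ≤ 1, and both bounds follow.
    have hbμ : b * μ ≤ 1 ∧ b * (μ + L) ≤ 2 := by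
      have h1 : b * L * L ≤ 1 * L := by linarith
      have h2 := le_of_mul_le_mul_right h1 hL
      have h3 : b * μ ≤ b * L := by gcongr
      constructor <;> linarith
    have hstep := (StronglyConvexSmooth.average hn hf).gradient_step hμL hb hbμ.1 hbμ.2
      (gradient_average_eq_zero hx) (avg u (x k))
    -- An exact gradient step, minus the error of ȳ as a gradient at x̄, minus the contribution of
    -- the tracking error.
    have hid : avg u (x (k + 1)) - xstar = (avg u (x k) - b • gradient g (avg u (x k)) - xstar) -
        b • (yb - gradient g (avg u (x k))) -
        avg u (mulRows (diagonal α) (y k - mulRows (projC v) (y k))) := by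
      rw [h.avg_x_succ hu, mulRows_sub, avg_sub, avg_diagonal_projC, smul_sub]
      abel
    have h1 : ‖avg u (mulRows (diagonal α) (y k - mulRows (projC v) (y k)))‖ ≤
        norm2 u / n * (a * e3) := by
      refine (norm_avg_le _ _).trans ?_
      refine mul_le_mul_of_nonneg_left ?_ (div_nonneg (norm2_nonneg _) (Nat.cast_nonneg n))
      refine (stackNorm_euclidean_mulRows_le _ _).trans ?_
      rw [matNorm2_diagonal]
      exact mul_le_mul (norm_le_alphaHat hα) hY2 (stackNorm_nonneg _ _) ha0
    have h2 : ‖b • (yb - gradient g (avg u (x k)))‖ ≤ b * (L / √n * e2) := by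
      rw [norm_smul, Real.norm_eq_abs, abs_of_nonneg hb]
      exact mul_le_mul_of_nonneg_left hy1 hb
    have h3 := norm_sub_le ((avg u (x k) - b • gradient g (avg u (x k)) - xstar) -
        b • (yb - gradient g (avg u (x k))))
        (avg u (mulRows (diagonal α) (y k - mulRows (projC v) (y k))))
    have h4 := norm_sub_le (avg u (x k) - b • gradient g (avg u (x k)) - xstar)
        (b • (yb - gradient g (avg u (x k))))
    rw [← hid] at h3
    calc ‖avg u (x (k + 1)) - xstar‖
        ≤ (1 - b * μ) * e1 + b * (L / √n * e2) + norm2 u / n * (a * e3) := by linarith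
      _ = (1 - b * μ) * e1 + b * L / √n * e2 + a * norm2 u / n * e3 := by ring
  · -- consensus error
    have h1 : stackNorm NR (mulRows (diagonal α) (y k)) ≤ a * (δRC * e3 + NR v * ‖yb‖) := by
      refine (stackNorm_diagonal_le hNR' (hNR.diagonal α) hα v (y k)).trans ?_
      gcongr
      exact stackNorm_le_mul hδ0' hδ' _
    have h2 := stackNorm_sub_le NR (mulRows (R - projR u) (x k - mulRows (projR u) (x k)))
      (mulRows (R - projR u) (mulRows (diagonal α) (y k)))
    rw [← h.consensus_succ hn hR hu] at h2
    have h3 := stackNorm_mulRows_le hNR' (R - projR u) (x k - mulRows (projR u) (x k))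
    have h4 := stackNorm_mulRows_le hNR' (R - projR u) (mulRows (diagonal α) (y k))
    have h5 : a * (δRC * e3 + NR v * ‖yb‖) ≤
        a * (δRC * e3 + NR v * (L * e1 + L / √n * e2)) := by
      gcongr
    have h6 := mul_le_mul_of_nonneg_left (h1.trans h5) hσ0
    calc stackNorm NR (x (k + 1) - mulRows (projR u) (x (k + 1)))
        ≤ sigmaR NR R u * e2 + sigmaR NR R u *
          (a * (δRC * e3 + NR v * (L * e1 + L / √n * e2))) := by
          rw [sigmaR] at *; linarith
      _ = a * sigmaR NR R u * NR v * L * e1 +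
          sigmaR NR R u * (1 + a * NR v * (L / √n)) * e2 + a * sigmaR NR R u * δRC * e3 := by ring
  · -- tracking error
    have h1 : stackNorm (euclideanSeminorm n) (mulRows (diagonal α) (y k)) ≤
        a * (e3 + norm2 v * (L * e1 + L / √n * e2)) := by
      refine (stackNorm_diagonal_le (fun _ => le_rfl) (matNorm_euclidean _) hα v (y k)).trans ?_
      rw [euclideanSeminorm_apply]
      have := norm2_nonneg v
      gcongr
    have h2 : stackNorm (euclideanSeminorm n) (x (k + 1) - x k) ≤ matNorm2 (R - 1) * e2 +
        matNorm2 R * (a * (e3 + norm2 v * (L * e1 + L / √n * e2))) := by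
      rw [h.x_succ_sub (u := u) hR]
      refine (stackNorm_sub_le _ _ _).trans (add_le_add ?_ ?_)
      · exact (stackNorm_euclidean_mulRows_le _ _).trans (mul_le_mul_of_nonneg_left hX2 hE0)
      · exact (stackNorm_euclidean_mulRows_le _ _).trans (mul_le_mul_of_nonneg_left h1 hr0)
    have h3 : stackNorm NC (stackGrad f (x (k + 1)) - stackGrad f (x k)) ≤
        δC2 * (L * (matNorm2 (R - 1) * e2 +
        matNorm2 R * (a * (e3 + norm2 v * (L * e1 + L / √n * e2))))) := by
      refine (stackNorm_le_mul (N' := euclideanSeminorm n) hδ0 hδ _).trans ?_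
      refine mul_le_mul_of_nonneg_left ((stackNorm_stackGrad_sub_le hf hL.le _ _).trans ?_) hδ0
      exact mul_le_mul_of_nonneg_left h2 hL.le
    have h4 := stackNorm_add_le NC (mulRows (C - projC v) (y k - mulRows (projC v) (y k)))
      (mulRows (1 - projC v) (stackGrad f (x (k + 1)) - stackGrad f (x k)))
    rw [← h.tracking_succ hn hRC.col hv] at h4
    have h5 := stackNorm_mulRows_le hNC' (C - projC v) (y k - mulRows (projC v) (y k))
    have h6 := (stackNorm_mulRows_le hNC' (1 - projC v)
      (stackGrad f (x (k + 1)) - stackGrad f (x k))).trans (mul_le_mul_of_nonneg_left h3 hc0)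
    calc stackNorm NC (y (k + 1) - mulRows (projC v) (y (k + 1)))
        ≤ sigmaC NC C v * e3 + c0 NC v * (δC2 * (L * (matNorm2 (R - 1) * e2 +
            matNorm2 R * (a * (e3 + norm2 v * (L * e1 + L / √n * e2)))))) := by
          rw [sigmaC, c0]; linarith
      _ = a * c0 NC v * δC2 * matNorm2 R * norm2 v * L ^ 2 * e1 +
          c0 NC v * δC2 * L * (matNorm2 (R - 1) + a * matNorm2 R * norm2 v * (L / √n)) * e2 +
          (sigmaC NC C v + a * c0 NC v * δC2 * matNorm2 R * L) * e3 := by ring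

end ErrorSystem

/-- Solutions of `z (k + 1) ≤ A z k` decay like `ρ(A) ^ k` for a nonnegative `3 × 3` matrix `A`
which is irreducible, or becomes so on deleting a vanishing middle row. -/
lemma isBigO_of_recursion_three {A : Matrix (Fin 3) (Fin 3) ℝ} (hA : ∀ i j, 0 ≤ A i j)
    (htop : spectralRadius ℂ (A.map (algebraMap ℝ ℂ)) ≠ ⊤)
    (h01 : 0 < A 0 1) (h21 : 0 < A 2 1) (h02 : 0 < A 0 2) (h20 : 0 < A 2 0) (h22 : 0 < A 2 2)
    (hrow : (∀ j, 0 < A 1 j) ∨ ∀ j, A 1 j = 0) {z : ℕ → Fin 3 → ℝ} (hz0 : ∀ k i, 0 ≤ z k i)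
    (hz : ∀ k i, z (k + 1) i ≤ (A *ᵥ z k) i) (i : Fin 3) :
    (fun k => z k i) =O[atTop] fun k => specRad A ^ k := by
  rcases hrow with hrow | hrow
  · obtain ⟨t, ht, w, hw, hAw⟩ := exists_pos_eigenvector hA 1
      (fun i => by fin_cases i <;> simp [h01, h21, hrow]) hrow
    obtain ⟨c, hc⟩ := le_pow_of_recursion hA hw hAw hz0 hz
    have hw0 : w ≠ 0 := fun h => (hw 0).ne' (congr_fun h 0)
    exact isBigO_specRad_pow ht.le (le_specRad htop ht.le hw0 hAw) (fun k => hz0 k i)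
      fun k => hc (k + 1) i
  -- The consensus error vanishes from time 1 on, so the other two errors obey a 2 × 2 recursion. An
  -- eigenvector of it, padded with 0, is one of A.
  · set B : Matrix (Fin 2) (Fin 2) ℝ := !![A 0 0, A 0 2; A 2 0, A 2 2] with hB
    have hB0 : ∀ i j, 0 ≤ B i j := fun i j => by
      fin_cases i <;> fin_cases j <;> exact hA _ _
    obtain ⟨t, ht, w, hw, hBw⟩ := exists_pos_eigenvector hB0 1
      (fun i => by fin_cases i <;> assumption) (fun j => by fin_cases j <;> assumption)
    have hz1 : ∀ k, z (k + 1) 1 = 0 := fun k => by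
      refine le_antisymm ((hz k 1).trans ?_) (hz0 _ _)
      rw [mulVec_apply_eq_sum]
      simp [hrow]
    obtain ⟨c, hc⟩ := le_pow_of_recursion hB0 hw hBw (z := fun k => ![z (k + 1) 0, z (k + 1) 2])
      (fun k i => by fin_cases i <;> exact hz0 _ _) (fun k i => by
        rw [mulVec_apply_eq_sum, Fin.sum_univ_two]
        have h0 := hz (k + 1) 0
        have h2 := hz (k + 1) 2
        rw [mulVec_apply_eq_sum, Fin.sum_univ_three, hz1, mul_zero, add_zero] at h0 h2
        fin_cases i
        · exact h0
        · exact h2)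
    have hAw : A *ᵥ ![w 0, 0, w 1] = t • ![w 0, 0, w 1] := by
      have e0 := congr_fun hBw 0
      have e1 := congr_fun hBw 1
      rw [mulVec_apply_eq_sum, Fin.sum_univ_two] at e0 e1
      ext i
      rw [mulVec_apply_eq_sum, Fin.sum_univ_three]
      fin_cases i
      · simpa [hB] using e0
      · simp [hrow]
      · simpa [hB] using e1
    have hw0 : (![w 0, 0, w 1] : Fin 3 → ℝ) ≠ 0 := fun h => (hw 0).ne' (congr_fun h 0)
    have hc0 : 0 ≤ c := by
      have := (hz0 1 0).trans (hc 0 0)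
      simpa using this
    -- Dividing by t compensates for the reduced recursion starting at time 1.
    refine isBigO_specRad_pow (c := c / t) ht.le (le_specRad htop ht.le hw0 hAw)
      (fun k => hz0 k i) fun k => ?_
    have e : c / t * t ^ (k + 1) = c * t ^ k := by
      rw [pow_succ']; field_simp
    rw [e]
    fin_cases i
    · exact hc k 0
    · change z (k + 1) 1 ≤ _
      rw [hz1]
      positivity
    · exact hc k 1

/-! ### The constants as polynomials in (√n)⁻¹, in the form used by the step size lemmas. -/

section Constants

variable {n : ℕ} (μ L M : ℝ) (R C : Matrix (Fin n) (Fin n) ℝ) (u v α : Fin n → ℝ)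
  (NR NC : Seminorm ℝ (Fin n → ℝ)) (δC2 δRC : ℝ)

lemma inv_sqrt_sq (n : ℕ) : ((√n)⁻¹) ^ 2 = (n : ℝ)⁻¹ := by
  rw [inv_pow, Real.sq_sqrt (Nat.cast_nonneg n)]

lemma c1_eq (hn : 0 < n) : c1 μ L M R u v NR NC δC2 δRC =
    sigmaR NR R u * (c0 NC v * δC2) * matNorm2 R * norm2 v * L ^ 2 * (√n)⁻¹ *
      (M * δRC * (L + μ) + (√n)⁻¹ ^ 2 * norm2 u * NR v * L) := by
  have hn' : (n : ℝ) ≠ 0 := by exact_mod_cast hn.ne'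
  rw [inv_sqrt_sq, c1, div_eq_mul_inv, mul_inv]
  field_simp

lemma c2_eq : c2 μ L M R C u v NR NC δC2 δRC =
    sigmaR NR R u * (c0 NC v * δC2) * norm2 u * NR v * matNorm2 (R - 1) * L ^ 2 * (√n)⁻¹ ^ 2 +
      (c0 NC v * δC2) * matNorm2 R * norm2 v * norm2 u * (1 - sigmaR NR R u) * L ^ 2 *
        (√n)⁻¹ ^ 2 / 2 +
      M * sigmaR NR R u * (c0 NC v * δC2) * δRC * matNorm2 (R - 1) * μ * L +
      M / 2 * sigmaR NR R u * NR v * (1 - sigmaC NC C v) * L ^ 2 * (√n)⁻¹ := by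
  rw [inv_sqrt_sq, c2]
  simp only [div_eq_mul_inv, mul_inv]
  ring

lemma transition_eq : transition μ L R C u v α NR NC δC2 δRC =
    !![1 - alphaPrime u v α * μ, alphaPrime u v α * (L * (√n)⁻¹),
        alphaHat α * norm2 u * (√n)⁻¹ ^ 2;
      alphaHat α * sigmaR NR R u * NR v * L,
        sigmaR NR R u * (1 + alphaHat α * NR v * (L * (√n)⁻¹)),
        alphaHat α * sigmaR NR R u * δRC;
      alphaHat α * (c0 NC v * δC2) * matNorm2 R * norm2 v * L ^ 2,
        c0 NC v * δC2 * L * (matNorm2 (R - 1) + alphaHat α * matNorm2 R * norm2 v * (L * (√n)⁻¹)),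
        sigmaC NC C v + alphaHat α * (c0 NC v * δC2) * matNorm2 R * L] := by
  rw [inv_sqrt_sq, transition]
  simp only [div_eq_mul_inv, mul_assoc]

end Constants

end PushPull

theorem theorem3p1 {n p : ℕ} (hn : 2 ≤ n) (hp : 1 ≤ p)
    (f : Fin n → EuclideanSpace ℝ (Fin p) → ℝ) (μ L : ℝ) (hμ : 0 < μ)
    (hf : ∀ i, PushPull.StronglyConvexSmooth μ L (f i))
    (xstar : EuclideanSpace ℝ (Fin p)) (hxstar : ∀ z, ∑ i, f i xstar ≤ ∑ i, f i z)
    (R C : Matrix (Fin n) (Fin n) ℝ) (hRC : PushPull.StochasticPair R C)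
    (hroot : (PushPull.roots R ∩ PushPull.roots Cᵀ).Nonempty)
    (u v : Fin n → ℝ) (hu : PushPull.IsLeftPerron R u) (hv : PushPull.IsRightPerron C v) :
    -- norms of the kind used in the analysis exist
    (∃ NR, PushPull.IsContractionNorm (R - PushPull.projR u) NR) ∧
    (∃ NC, PushPull.IsContractionNorm (C - PushPull.projC v) NC) ∧
    -- and for every choice of such norms the method converges linearly
    ∀ (NR NC : Seminorm ℝ (Fin n → ℝ)),
      PushPull.IsContractionNorm (R - PushPull.projR u) NR →
      PushPull.IsContractionNorm (C - PushPull.projC v) NC →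
    ∀ (δC2 δRC : ℝ), (∀ w, NC w ≤ δC2 * PushPull.norm2 w) → (∀ w, NR w ≤ δRC * NC w) →
    ∀ (α : Fin n → ℝ), (∀ i, 0 ≤ α i) → (∃ i, 0 < α i) →
    ∀ (M : ℝ), 0 < M → M * PushPull.alphaHat α ≤ PushPull.alphaPrime u v α →
      PushPull.alphaHat α ≤ PushPull.stepBound μ L M R C u v NR NC δC2 δRC →
      -- equality is excluded in the degenerate case `R = 1 uᵀ / n`
      (PushPull.sigmaR NR R u = 0 →
        PushPull.alphaHat α < PushPull.stepBound μ L M R C u v NR NC δC2 δRC) →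
      -- for `σ_C = 0` the second bound reads `α̂ ≤ ∞`
      (PushPull.sigmaC NC C v ≠ 0 →
        PushPull.alphaHat α ≤ (1 - PushPull.sigmaC NC C v) /
          (2 * PushPull.sigmaC NC C v * δC2 * PushPull.matNorm2 R * L)) →
    ∀ (x y : ℕ → Fin n → EuclideanSpace ℝ (Fin p)), PushPull.IsTrajectory f R C α x y →
      PushPull.specRad (PushPull.transition μ L R C u v α NR NC δC2 δRC) < 1 ∧
      (fun k => ‖PushPull.avg u (x k) - xstar‖) =O[atTop]
        (fun k => PushPull.specRad (PushPull.transition μ L R C u v α NR NC δC2 δRC) ^ k) ∧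
      (fun k => PushPull.stackNorm NR (fun i => x k i - PushPull.avg u (x k))) =O[atTop]
        (fun k => PushPull.specRad (PushPull.transition μ L R C u v α NR NC δC2 δRC) ^ k) ∧
      (fun k => PushPull.stackNorm NC
          (fun i => y k i - v i • PushPull.avg (fun _ => 1) (y k))) =O[atTop]
        (fun k => PushPull.specRad (PushPull.transition μ L R C u v α NR NC δC2 δRC) ^ k) := by
  have hn0 : 0 < n := by omega
  refine ⟨hRC.exists_contractionNorm_row hn0 (hroot.mono Set.inter_subset_left) hu,
    hRC.exists_contractionNorm_col hn0 (hroot.mono Set.inter_subset_right) hv, ?_⟩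
  intro NR NC hNR hNC δC2 δRC hδ hδ' α hα hαpos M hM hMb hstep hstrict _ x y hxy
  have hnR : (0 : ℝ) < n := by exact_mod_cast hn0
  have hμL : μ ≤ L := (hf ⟨0, hn0⟩).le_of_pos hp
  have hL : 0 < L := hμ.trans_le hμL
  have ha : 0 < PushPull.alphaHat α := by
    obtain ⟨i, hi⟩ := hαpos
    exact hi.trans_le (PushPull.le_alphaHat α i)
  have hb : 0 < PushPull.alphaPrime u v α := (mul_pos hM ha).trans_le hMb
  have hR : R *ᵥ (fun _ => 1) = fun _ => 1 := hRC.row.2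
  have hU : 0 < PushPull.norm2 u := PushPull.norm2_pos (PushPull.ne_zero_of_sum_eq hn0 hu.sum_eq)
  have hV : 0 < PushPull.norm2 v := PushPull.norm2_pos (PushPull.ne_zero_of_sum_eq hn0 hv.sum_eq)
  have hw : 0 < NR v := hV.trans_le (hNR.norm2_le v)
  have hr : 0 < PushPull.matNorm2 R := one_pos.trans_le (PushPull.one_le_matNorm2 hn0 hR)
  have hE : 0 ≤ PushPull.matNorm2 (R - 1) := PushPull.matNorm2_nonneg _
  have hδ1 : 1 ≤ δC2 := PushPull.one_le_of_le_mul hn0 hNC.norm2_le hδ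
  have hD : 0 < δRC := PushPull.pos_of_le_mul hn0 hNR.norm2_le hδ'
  have hK : 0 < PushPull.c0 NC v * δC2 :=
    mul_pos (one_pos.trans_le (PushPull.one_le_c0 hn hNC.norm2_le v)) (by linarith)
  have hσ0 : 0 ≤ PushPull.sigmaR NR R u := PushPull.matNorm_nonneg _ _
  have hσ1 : PushPull.sigmaR NR R u < 1 := hNR.contraction
  have hτ0 : 0 ≤ PushPull.sigmaC NC C v := PushPull.matNorm_nonneg _ _
  have hτ1 : PushPull.sigmaC NC C v < 1 := hNC.contraction
  have hsq : 0 < √(n : ℝ) := Real.sqrt_pos.2 hnR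
  have hq : 0 < (√(n : ℝ))⁻¹ := inv_pos.2 hsq
  have hs : 0 < 1 - PushPull.sigmaR NR R u := sub_pos.2 hσ1
  have ht : 0 < 1 - PushPull.sigmaC NC C v := sub_pos.2 hτ1
  -- the average `uᵀ v / n`
  have hbm := PushPull.alphaPrime_le (α := α) hu.nonneg hv.nonneg
  have hm : 0 < (∑ j, u j * v j) / n := pos_of_mul_pos_right (hb.trans_le hbm) ha.le
  have hMm : M ≤ (∑ j, u j * v j) / n :=
    le_of_mul_le_mul_left (by rw [mul_comm]; exact hMb.trans hbm) ha
  -- Cauchy–Schwarz for uᵀv.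
  have hMUV : M ≤ PushPull.norm2 u * PushPull.norm2 v * (√(n : ℝ))⁻¹ ^ 2 := by
    rw [PushPull.inv_sqrt_sq, ← div_eq_mul_inv]
    exact hMm.trans (div_le_div_of_nonneg_right (PushPull.dotProduct_le_norm2 u v) hnR.le)
  -- the quadratic form of the step size bound
  have hc1 : 0 ≤ PushPull.c1 μ L M R u v NR NC δC2 δRC := by
    rw [PushPull.c1_eq μ L M R u v NR NC δC2 δRC hn0]; positivity
  -- Strict even for σ_R = 0, since the second summand has no factor σ_R.
  have hc2 : 0 < PushPull.c2 μ L M R C u v NR NC δC2 δRC := by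
    rw [PushPull.c2_eq]; positivity
  have hc3 : 0 < PushPull.c3 μ M R C u v NR NC := by
    rw [PushPull.c3]; positivity
  obtain ⟨hle, hlt⟩ := PushPull.quadratic_le_of_le_root hc1 hc2 hc3 ha.le
  have hquad := hle hstep
  have hquad' := fun h => hlt (hstrict h)
  rw [PushPull.c1_eq μ L M R u v NR NC δC2 δRC hn0, PushPull.c2_eq, PushPull.c3] at hquad hquad'
  obtain ⟨-, h22, -, -, h33⟩ := PushPull.step_size_diag hμ hμL hM ha hU hV hw hq hσ0 hσ1 hτ1 hK hD
    hr hE hMUV hquad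
  have hdet := PushPull.step_size_det hμ hμL hM ha hU hV hw hq hσ0 hσ1 hτ1 hK hD hr hE hMUV hMb
    hquad hquad'
  have hbL : PushPull.alphaPrime u v α * L ^ 2 ≤ μ := by
    refine PushPull.step_size_average hμ hμL hM ha hU hV hw hq hσ0 hσ1 hτ0 hτ1 hK hD hr hm hMUV hbm
      (PushPull.one_sub_sigmaR_le hn hu hNR.norm2_le) ?_ ?_ hquad
    · rw [← div_eq_mul_inv, le_div_iff₀ hsq]
      exact PushPull.dotProduct_perron_le hNR.norm2_le hm.le
    · rw [← div_eq_mul_inv, div_le_iff₀ hsq]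
      exact PushPull.norm2_le_c0 hn hNC.norm2_le hδ v
  have hbμ : PushPull.alphaPrime u v α * μ ≤ 1 := by
    have h1 : PushPull.alphaPrime u v α * L * L ≤ 1 * L := by linarith
    have h2 := le_of_mul_le_mul_right h1 hL
    exact (mul_le_mul_of_nonneg_left hμL hb.le).trans h2
  have hrec := hxy.errors_succ_le hn0 hf hμ hμL hxstar hRC hu hv hNR hNC (by linarith) hD.le hδ hδ'
    hα hb.le hbL
  have hAeq := PushPull.transition_eq μ L R C u v α NR NC δC2 δRC
  set A := PushPull.transition μ L R C u v α NR NC δC2 δRC with hAdef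
  have hA : ∀ i j, 0 ≤ A i j := fun i j => by
    have h00 := sub_nonneg.2 hbμ
    rw [hAeq]
    fin_cases i <;> fin_cases j <;> simp <;> first | linarith | positivity
  obtain ⟨w, hw0, hAw⟩ : ∃ w : Fin 3 → ℝ, (∀ i, 0 < w i) ∧ ∀ i, (A *ᵥ w) i < w i := by
    rw [hAeq]
    refine PushPull.exists_pos_mulVec_lt ?_ ?_ ?_ ?_ ?_ ?_ ?_ ?_ ?_ hdet
    any_goals positivity
    · have := mul_pos hb hμ
      linarith
    · linarith
    · linarith
  obtain ⟨hρ, htop⟩ := PushPull.specRad_lt_one hA hw0 hAw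
  -- Every entry of the middle row carries the factor σ_R, with a positive cofactor.
  have hrow : (∀ j, 0 < A 1 j) ∨ ∀ j, A 1 j = 0 := by
    rcases hσ0.eq_or_lt with h | h
    · right
      intro j
      rw [hAeq, ← h]
      fin_cases j <;> simp
    · left
      intro j
      rw [hAeq]
      fin_cases j <;> simp <;> positivity
  have hO := PushPull.isBigO_of_recursion_three hA htop (by rw [hAeq]; simp; positivity)
    (by rw [hAeq]; simp; positivity) (by rw [hAeq]; simp; positivity)
    (by rw [hAeq]; simp; positivity) (by rw [hAeq]; simp; positivity) hrow
    (z := fun k => PushPull.errors u v NR NC xstar (x k) (y k))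
    (fun k i => PushPull.errors_nonneg i _ _) hrec
  refine ⟨hρ, hO 0, ?_, ?_⟩
  · simp only [PushPull.stackNorm_sub_avg_eq]
    exact hO 1
  · simp only [PushPull.stackNorm_sub_smul_avg_eq]
    exact hO 2
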